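/- Let $\Omega\subseteq\mathbb R^n$ be open and let $G^\alpha_{\beta\gamma},Q^\alpha\colon\Omega\to\mathbb R$ be smooth ($\alpha,\beta,\gamma=1,\dots,n$). Consider the chiral-type system $$\Delta^\alpha\equiv U^\alpha_{xy}+G^\alpha_{\beta\gamma}(U)\,U^\beta_xU^\gamma_y+Q^\alpha(U)=0$$ for $U=(U^1,\dots,U^n)$ as a function of $(x,y)$ (summation over repeated indices). A differential function over an open set $V\subseteq\Omega$ is a smooth function of $x,y$, $U\in V$ and finitely many partial derivatives of $U$; $D_x,D_y$ denote the total derivatives, and $E_\alpha=\sum_{i,j\ge0}(-D_x)^i(-D_y)^j\,\partial/\partial U^\alpha_{x^iy^j}$ is the $\alpha$-th Euler operator. A tuple $(R_\alpha)$ of differential functions is the characteristic of a conservation law over $V$ if there are differential functions $L_1,L_2$ over $V$ with $D_xL_1+D_yL_2=R_\alpha\Delta^\alpha$ identically in all jet variables with $U\in V$. Let $\mathfrak g$ be a (real or complex) matrix Lie algebra, and suppose that the system admits a Lax representation in $\mathfrak g$, that is, there are smooth functions $A_\alpha,B_\alpha,M,N\colon\Omega\to\mathfrak g$ and functions $S_\alpha\colon\Omega\to\mathfrak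 g$ such that $\widetilde A=A_\alpha U^\alpha_x+M$ and $\widetilde B=B_\alpha U^\alpha_y+N$ satisfy $$D_y\widetilde A-D_x\widetilde B+[\widetilde A,\widetilde B]=S_\alpha\Delta^\alpha$$ identically in the jet variables with $U\in\Omega$. Let $p\ge1$, and let $f$ be a symmetric $p$-linear form on $\mathfrak g$ with real or complex values which is ad-invariant, i.e. $\sum_{i=1}^p f(x_1,\dots,[y,x_i],\dots,x_p)=0$ for all $y,x_1,\dots,x_p\in\mathfrak g$. Then: 1. $S_\alpha=A_\alpha-B_\alpha$ on $\Omega$. 2. Both $$R_\alpha=f(S_\alpha,\underbrace{M,\dots,M}_{p-1}),\qquad \widetilde R_\alpha=f(S_\alpha,\underbrace{N,\dots,N}_{p-1})$$ are characteristics of conservation laws of the system over every star-shaped open set $V\subseteq\Omega$ (hence near every point of $\Omega$, and over $\Omega$ itself if $\Omega$ is star-shaped, for example $\Omega=\mathbb R^n$). 3. Over all of $\Omega$, $E_\alpha(R_\beta\Delta^\beta)=0$ and $E_\alpha(\widetilde R_\beta\Delta^\beta)=0$ for every $\alpha$; by the Lax identity, $R_\beta\Delta^\beta=f(D_y\widetilde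 A-D_x\widetilde B+[\widetilde A,\widetilde B],M,\dots,M)$, and likewise $\widetilde R_\beta\Delta^\beta$ with $N$ in place of $M$. -/

import Mathlib

open scoped ContDiff

/- The Lie bracket of square matrices is the commutator. -/
attribute [local instance 100] LieRing.ofAssociativeRing

noncomputable section

namespace ChiralType

/-! ### Differential functions, total derivatives, Euler operators

Two independent variables `x, y` and `n` dependent variables `U^1, …, U^n`. -/

/-- Points of the infinite jet space: `(x, y, (u i j α))`, where `u i j α` is the jet coordinate
of the derivative of `U^α` taken `i` times in `x` and `j` times in `y`. -/
abbrev JetSpace (n : ℕ) : Type := ℝ × ℝ × (ℕ → ℕ → Fin n → ℝ)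

/-- The jet coordinate `u i j` (a vector with one entry for each dependent variable). -/
def jet {n : ℕ} (z : JetSpace n) (i j : ℕ) : Fin n → ℝ := z.2.2 i j

/-- The value `(U^1, …, U^n)` of the dependent variables. -/
def fieldValue {n : ℕ} (z : JetSpace n) : Fin n → ℝ := jet z 0 0

/-- Finitely many jet coordinates, together with `x` and `y`. -/
abbrev FiniteJet (n k : ℕ) : Type := ℝ × ℝ × (Fin (k + 1) → Fin (k + 1) → Fin n → ℝ)

/-- Forget all jet coordinates except those with at most `k` derivatives in each variable. -/
def truncate {n : ℕ} (k : ℕ) (z : JetSpace n) : FiniteJet n k :=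
  (z.1, z.2.1, fun i j => z.2.2 i j)

/-- `P` is a differential function over the domain `V` of the dependent variables: a smooth
function of `x`, `y`, of `U ∈ V`, and of finitely many derivatives of `U` (which are
unrestricted). -/
def IsDifferentialFunction {n : ℕ} {E : Type*} [NormedAddCommGroup E] [NormedSpace ℝ E]
    (V : Set (Fin n → ℝ)) (P : JetSpace n → E) : Prop :=
  ∃ (k : ℕ) (F : FiniteJet n k → E),
    ContDiffOn ℝ ∞ F {w | w.2.2 0 0 ∈ V} ∧
      ∀ z, fieldValue z ∈ V → P z = F (truncate k z)

section Operators

variable {n : ℕ} {E : Type*} [NormedAddCommGroup E] [NormedSpace ℝ E]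

/-- The total derivative `D_x = ∂/∂x + ∑ u^α_{i+1,j} ∂/∂u^α_{i,j}`, i.e. the derivative along
this vector field on the jet space. -/
def Dx (P : JetSpace n → E) (z : JetSpace n) : E :=
  deriv (fun t : ℝ => P (z + t • (((1 : ℝ), (0 : ℝ), fun i j => jet z (i + 1) j) : JetSpace n))) 0

/-- The total derivative `D_y = ∂/∂y + ∑ u^α_{i,j+1} ∂/∂u^α_{i,j}`. -/
def Dy (P : JetSpace n → E) (z : JetSpace n) : E :=
  deriv (fun t : ℝ => P (z + t • (((0 : ℝ), (1 : ℝ), fun i j => jet z i (j + 1)) : JetSpace n))) 0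

/-- The partial derivative `∂P/∂u^α_{i,j}`. -/
def jetPartial (i j : ℕ) (α : Fin n) (P : JetSpace n → E) (z : JetSpace n) : E :=
  deriv (fun t : ℝ => P (z + t • (((0 : ℝ), (0 : ℝ),
    Pi.single i (Pi.single j (Pi.single α (1 : ℝ)))) : JetSpace n))) 0

/-- The Euler operator `E_α = ∑_J (-D)_J ∂/∂u^α_J`, the sum over all multi-indices `J = (i, j)`
(for a differential function only finitely many terms are nonzero). -/
def euler (α : Fin n) (P : JetSpace n → E) (z : JetSpace n) : E :=
  ∑ᶠ J : ℕ × ℕ, (-1 : ℝ) ^ (J.1 + J.2) • Dx^[J.1] (Dy^[J.2] (jetPartial J.1 J.2 α P)) z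

end Operators

/-! ### Conservation laws and their characteristics -/

/-- `R` is the characteristic of a conservation law, over the domain `V` of the dependent
variables, of the system `Δ^1 = 0, …, Δ^n = 0`: there are differential functions `L₁, L₂` with
`D_x L₁ + D_y L₂ = R_α Δ^α` identically on the jet space. -/
def IsCharacteristic {n : ℕ} {E : Type*} [NormedAddCommGroup E] [NormedSpace ℝ E]
    (V : Set (Fin n → ℝ)) (Δ : Fin n → JetSpace n → ℝ) (R : Fin n → JetSpace n → E) : Prop :=
  (∀ α, IsDifferentialFunction V (R α)) ∧
    ∃ L₁ L₂ : JetSpace n → E, IsDifferentialFunction V L₁ ∧ IsDifferentialFunction V L₂ ∧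
      ∀ z, fieldValue z ∈ V → Dx L₁ z + Dy L₂ z = ∑ α, Δ α z • R α z

/-! ### Chiral-type systems and Lax representations -/

/-- The left-hand side `Δ^α = U^α_{xy} + G^α_{βγ} U^β_x U^γ_y + Q^α` of a chiral-type system. -/
def chiralLHS {n : ℕ} (G : Fin n → Fin n → Fin n → (Fin n → ℝ) → ℝ)
    (Q : Fin n → (Fin n → ℝ) → ℝ) (α : Fin n) (z : JetSpace n) : ℝ :=
  jet z 1 1 α + ∑ β, ∑ γ, G α β γ (fieldValue z) * jet z 1 0 β * jet z 0 1 γ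
    + Q α (fieldValue z)

section Lax

variable {n m : ℕ} {𝕂 : Type*} [RCLike 𝕂] {𝔤 : LieSubalgebra ℝ (Matrix (Fin m) (Fin m) 𝕂)}

/-- A function with values in a matrix Lie algebra is smooth on `Ω`, i.e. all of its matrix
entries are. -/
def SmoothMatrixOn (Ω : Set (Fin n → ℝ)) (X : (Fin n → ℝ) → 𝔤) : Prop :=
  ∀ i j, ContDiffOn ℝ ∞ (fun u => (X u : Matrix (Fin m) (Fin m) 𝕂) i j) Ω

/-- The Lax matrix `Ã = A_α U^α_x + M`. -/
def laxA (A : Fin n → (Fin n → ℝ) → 𝔤) (M : (Fin n → ℝ) → 𝔤) (z : JetSpace n) :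
    Matrix (Fin m) (Fin m) 𝕂 :=
  ∑ α, jet z 1 0 α • (A α (fieldValue z) : Matrix (Fin m) (Fin m) 𝕂) + M (fieldValue z)

/-- The Lax matrix `B̃ = B_α U^α_y + N`. -/
def laxB (B : Fin n → (Fin n → ℝ) → 𝔤) (N : (Fin n → ℝ) → 𝔤) (z : JetSpace n) :
    Matrix (Fin m) (Fin m) 𝕂 :=
  ∑ α, jet z 0 1 α • (B α (fieldValue z) : Matrix (Fin m) (Fin m) 𝕂) + N (fieldValue z)

/-- Entrywise total derivative of a matrix-valued function. -/
def matrixDx (X : JetSpace n → Matrix (Fin m) (Fin m) 𝕂) (z : JetSpace n) :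
    Matrix (Fin m) (Fin m) 𝕂 :=
  Matrix.of fun i j => Dx (fun w => X w i j) z

/-- Entrywise total derivative of a matrix-valued function. -/
def matrixDy (X : JetSpace n → Matrix (Fin m) (Fin m) 𝕂) (z : JetSpace n) :
    Matrix (Fin m) (Fin m) 𝕂 :=
  Matrix.of fun i j => Dy (fun w => X w i j) z

/-- The functions `A_α, B_α, M, N, S_α` of `U ∈ Ω` with values in `𝔤` form a Lax representation
`D_y Ã - D_x B̃ + [Ã, B̃] = S_α Δ^α`, `Ã = A_α U^α_x + M`, `B̃ = B_α U^α_y + N`,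
of the system with left-hand sides `Δ^α`; the identity is one on the jet space. -/
structure IsLaxRepresentation (Ω : Set (Fin n → ℝ)) (Δ : Fin n → JetSpace n → ℝ)
    (A B : Fin n → (Fin n → ℝ) → 𝔤) (M N : (Fin n → ℝ) → 𝔤)
    (S : Fin n → (Fin n → ℝ) → 𝔤) : Prop where
  smooth_A : ∀ α, SmoothMatrixOn Ω (A α)
  smooth_B : ∀ α, SmoothMatrixOn Ω (B α)
  smooth_M : SmoothMatrixOn Ω M
  smooth_N : SmoothMatrixOn Ω N
  identity : ∀ z, fieldValue z ∈ Ω →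
    matrixDy (laxA A M) z - matrixDx (laxB B N) z + ⁅laxA A M z, laxB B N z⁆ =
      ∑ α, Δ α z • (S α (fieldValue z) : Matrix (Fin m) (Fin m) 𝕂)

end Lax

/-! ### Invariant forms -/

section Forms

variable {𝔤 W : Type*} [LieRing 𝔤] [LieAlgebra ℝ 𝔤] [AddCommGroup W] [Module ℝ W] {p : ℕ}

/-- The multilinear form `f` is symmetric. -/
def IsSymmetricForm (f : MultilinearMap ℝ (fun _ : Fin p => 𝔤) W) : Prop :=
  ∀ (σ : Equiv.Perm (Fin p)) (x : Fin p → 𝔤), f (fun i => x (σ i)) = f x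

/-- The multilinear form `f` is ad-invariant:
`f([y,x₁],x₂,…,x_p) + f(x₁,[y,x₂],…,x_p) + … + f(x₁,x₂,…,[y,x_p]) = 0`. -/
def IsAdInvariant (f : MultilinearMap ℝ (fun _ : Fin p => 𝔤) W) : Prop :=
  ∀ (y : 𝔤) (x : Fin p → 𝔤), ∑ i, f (Function.update x i ⁅y, x i⁆) = 0

/-- For a form in `p = q + 1` arguments, the functions `R_α = f(S_α, X, …, X)`
(with `q = p - 1` arguments `X`) of the dependent variables. -/
def formCharacteristic {n q : ℕ} (f : MultilinearMap ℝ (fun _ : Fin (q + 1) => 𝔤) W)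
    (S : Fin n → (Fin n → ℝ) → 𝔤) (X : (Fin n → ℝ) → 𝔤) (α : Fin n) (z : JetSpace n) : W :=
  f (Fin.cons (S α (fieldValue z)) fun _ => X (fieldValue z))

end Forms

end ChiralType

end

/-!
Write `A, B` for the one-forms `A_α dU^α`, `B_α dU^α`. Comparing coefficients of the jet
coordinates, the Lax identity is equivalent to `S = A - B` together with

* `∂_β A_α - ∂_α B_β + [A_α, B_β] = S_γ G^γ_{αβ}`,
* `∂_β M = [B_β, M]`, `∂_α N = [A_α, N]`, `[M, N] = S_α Q^α`

(`LaxCoefficients`). So `M` is covariantly constant for the connection `d - B`. For an ad-invariant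
form, differentiating `f(X, M, …, M)` therefore amounts to differentiating `X` covariantly
(`coordDeriv_formValue`), and with `a_α = f(A_α, M, …, M)`, `b_α = f(B_α, M, …, M)`,
`η_{αβ} = f([B_α, B_β], M, …, M)` the function `R_γ Δ^γ` becomes

`(a_γ - b_γ) U^γ_{xy} + (∂_β a_α - ∂_α b_β - η_{αβ}) U^α_x U^β_y`,

because `f([M, N], M, …, M) = 0` by invariance and symmetry. The essential point is that the
two-form `η` is closed (`LaxCoefficients.closed`): `M` being covariantly constant, the curvature of
`d - B` commutes with `M`, and invariance then kills every term `f([F, X], M, …, M)` with `F` a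
value of the curvature; what remains vanishes by the Jacobi identity.

On a star-shaped domain `η = dθ` by the Poincaré lemma (`exists_primitive_of_closed_twoForm`), and
`R_γ Δ^γ = D_x(-(b_β + θ_β) U^β_y) + D_y((a_α + θ_α) U^α_x)`. On an arbitrary domain the Euler
operators of a function `r_γ U^γ_{xy} + h_{αβ} U^α_x U^β_y` are computed explicitly
(`euler_quasilinear_eq_zero`), and their vanishing reduces to `dη = 0`. The statements for `N`
follow by interchanging `x` and `y`, under which `(A, M)` and `(B, N)` change places
(`LaxCoefficients.swap`, `IsConserved.swap`).

Coordinates on the matrix Lie algebra `𝔤` turn everything into calculus of functions with values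
in a finite-dimensional normed space that carries a continuous bracket.
-/

noncomputable section

namespace ChiralType

/-! ### Coordinate derivatives -/

section CoordDeriv

variable {n : ℕ} {E F H : Type*} [NormedAddCommGroup E] [NormedSpace ℝ E]
  [NormedAddCommGroup F] [NormedSpace ℝ F] [NormedAddCommGroup H] [NormedSpace ℝ H]
  {Ω : Set (Fin n → ℝ)}

/-- The partial derivative `∂_α X` of a function of the dependent variables. -/
def coordDeriv (α : Fin n) (X : (Fin n → ℝ) → E) (u : Fin n → ℝ) : E :=
  fderiv ℝ X u (Pi.single α 1)

theorem fderiv_eq_sum_coordDeriv (X : (Fin n → ℝ) → E) (u v : Fin n → ℝ) :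
    fderiv ℝ X u v = ∑ α, v α • coordDeriv α X u := by
  conv_lhs => rw [pi_eq_sum_univ' v]
  simp only [map_sum, map_smul, coordDeriv]

theorem smooth_differentiableAt {X : (Fin n → ℝ) → E} (hΩ : IsOpen Ω) (hX : ContDiffOn ℝ ∞ X Ω)
    {u : Fin n → ℝ} (hu : u ∈ Ω) : DifferentiableAt ℝ X u :=
  (hX.differentiableOn (by simp)).differentiableAt (hΩ.mem_nhds hu)

theorem smooth_coordDeriv {X : (Fin n → ℝ) → E} (hΩ : IsOpen Ω) (hX : ContDiffOn ℝ ∞ X Ω)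
    (α : Fin n) : ContDiffOn ℝ ∞ (coordDeriv α X) Ω :=
  ((contDiffOn_infty_iff_fderiv_of_isOpen hΩ).1 hX).2.clm_apply contDiffOn_const

theorem coordDeriv_congr {X Y : (Fin n → ℝ) → E} (hΩ : IsOpen Ω) (h : ∀ u ∈ Ω, X u = Y u)
    (α : Fin n) {u : Fin n → ℝ} (hu : u ∈ Ω) : coordDeriv α X u = coordDeriv α Y u := by
  have : X =ᶠ[nhds u] Y := Filter.eventuallyEq_of_mem (hΩ.mem_nhds hu) h
  simp only [coordDeriv, this.fderiv_eq]

theorem coordDeriv_comm {X : (Fin n → ℝ) → E} (hΩ : IsOpen Ω) (hX : ContDiffOn ℝ ∞ X Ω)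
    (α β : Fin n) {u : Fin n → ℝ} (hu : u ∈ Ω) :
    coordDeriv α (coordDeriv β X) u = coordDeriv β (coordDeriv α X) u := by
  have hd : DifferentiableAt ℝ (fderiv ℝ X) u :=
    smooth_differentiableAt hΩ ((contDiffOn_infty_iff_fderiv_of_isOpen hΩ).1 hX).2 hu
  have key : ∀ γ δ : Fin n, coordDeriv γ (coordDeriv δ X) u
      = fderiv ℝ (fderiv ℝ X) u (Pi.single γ 1) (Pi.single δ 1) := by
    intro γ δ
    have h := hd.hasFDerivAt.clm_apply (hasFDerivAt_const (Pi.single δ (1 : ℝ)) u)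
    have h' : fderiv ℝ (coordDeriv δ X) u = _ := h.fderiv
    rw [coordDeriv, h']
    simp
  rw [key, key]
  exact (hX.contDiffAt (hΩ.mem_nhds hu)).isSymmSndFDerivAt
    (by rw [minSmoothness_of_isRCLikeNormedField]; exact WithTop.coe_le_coe.2 le_top) _ _

theorem coordDeriv_add {X Y : (Fin n → ℝ) → E} {u : Fin n → ℝ} (hX : DifferentiableAt ℝ X u)
    (hY : DifferentiableAt ℝ Y u) (α : Fin n) :
    coordDeriv α (fun v => X v + Y v) u = coordDeriv α X u + coordDeriv α Y u := by
  simp [coordDeriv, fderiv_fun_add hX hY]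

theorem coordDeriv_sub {X Y : (Fin n → ℝ) → E} {u : Fin n → ℝ} (hX : DifferentiableAt ℝ X u)
    (hY : DifferentiableAt ℝ Y u) (α : Fin n) :
    coordDeriv α (fun v => X v - Y v) u = coordDeriv α X u - coordDeriv α Y u := by
  simp [coordDeriv, fderiv_fun_sub hX hY]

theorem coordDeriv_neg (X : (Fin n → ℝ) → E) (u : Fin n → ℝ) (α : Fin n) :
    coordDeriv α (fun v => -X v) u = -coordDeriv α X u := by
  simp [coordDeriv, fderiv_fun_neg]

theorem coordDeriv_clm (L : E →L[ℝ] F) {X : (Fin n → ℝ) → E} {u : Fin n → ℝ}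
    (hX : DifferentiableAt ℝ X u) (α : Fin n) :
    coordDeriv α (fun v => L (X v)) u = L (coordDeriv α X u) := by
  have h : fderiv ℝ (fun v => L (X v)) u = _ := (L.hasFDerivAt.comp u hX.hasFDerivAt).fderiv
  simp [coordDeriv, h]

theorem coordDeriv_bilinear (br : E →L[ℝ] F →L[ℝ] H) {X : (Fin n → ℝ) → E} {Y : (Fin n → ℝ) → F}
    {u : Fin n → ℝ} (hX : DifferentiableAt ℝ X u) (hY : DifferentiableAt ℝ Y u) (α : Fin n) :
    coordDeriv α (fun v => br (X v) (Y v)) u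
      = br (coordDeriv α X u) (Y u) + br (X u) (coordDeriv α Y u) := by
  have h := br.hasFDerivAt_of_bilinear hX.hasFDerivAt hY.hasFDerivAt
  simp [coordDeriv, h.fderiv, add_comm]

end CoordDeriv

/-! ### The Poincaré lemma for two-forms -/

section Poincare

open MeasureTheory intervalIntegral

universe u₀

variable {n : ℕ}

/-- Local uniform bounds over the compact parameter interval `[0, 1]`. -/
theorem exists_ball_bound {E : Type*} [NormedAddCommGroup E]
    {O : Set ((Fin n → ℝ) × ℝ)} (hO : IsOpen O) {F : (Fin n → ℝ) × ℝ → E}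
    (hF : ContinuousOn F O) {u : Fin n → ℝ} (hu : ∀ t ∈ Set.Icc (0 : ℝ) 1, (u, t) ∈ O) :
    ∃ C, ∃ s ∈ nhds u, ∀ v ∈ s, ∀ t ∈ Set.Icc (0 : ℝ) 1, (v, t) ∈ O ∧ ‖F (v, t)‖ ≤ C := by
  obtain ⟨C, hC⟩ := (isCompact_Icc (a := (0 : ℝ)) (b := 1)).exists_bound_of_continuousOn
    (f := fun t => F (u, t)) (hF.comp (by fun_prop) hu)
  have hO' : IsOpen (O ∩ F ⁻¹' {x | ‖x‖ < C + 1}) :=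
    hF.isOpen_inter_preimage hO (isOpen_lt continuous_norm continuous_const)
  obtain ⟨s, t, hs, -, hus, hIt, hst⟩ := generalized_tube_lemma (isCompact_singleton (x := u))
    (isCompact_Icc (a := (0 : ℝ)) (b := 1)) hO' (by
      rintro ⟨v, t⟩ ⟨rfl, ht⟩
      exact ⟨hu t ht, lt_of_le_of_lt (hC t ht) (by linarith)⟩)
  refine ⟨C + 1, s, hs.mem_nhds (hus rfl), fun v hv r hr => ?_⟩
  have := hst (Set.mk_mem_prod hv (hIt hr))
  exact ⟨this.1, le_of_lt this.2⟩

variable {V : Set (Fin n → ℝ)} {O : Set ((Fin n → ℝ) × ℝ)}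

theorem aestronglyMeasurable_slice {E : Type*} [NormedAddCommGroup E] {F : (Fin n → ℝ) × ℝ → E}
    (hF : ContinuousOn F O) {u : Fin n → ℝ}
    (hu : ∀ t ∈ Set.Icc (0 : ℝ) 1, (u, t) ∈ O) :
    AEStronglyMeasurable (fun t => F (u, t)) (volume.restrict (Set.uIoc (0 : ℝ) 1)) := by
  have hc : ContinuousOn (fun t => F (u, t)) (Set.Icc 0 1) := hF.comp (by fun_prop) hu
  rw [Set.uIoc_of_le zero_le_one]
  exact (hc.mono Set.Ioc_subset_Icc_self).aestronglyMeasurable measurableSet_Ioc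

theorem continuousOn_parametric_integral {E : Type*} [NormedAddCommGroup E] [NormedSpace ℝ E]
    (hV : IsOpen V) (hO : IsOpen O) (hVO : ∀ u ∈ V, ∀ t ∈ Set.Icc (0 : ℝ) 1, (u, t) ∈ O)
    {F : (Fin n → ℝ) × ℝ → E} (hF : ContinuousOn F O) :
    ContinuousOn (fun u => ∫ t in (0 : ℝ)..1, F (u, t)) V := by
  intro u hu
  obtain ⟨C, s, hs, hsC⟩ := exists_ball_bound hO hF (hVO u hu)
  have hIcc : ∀ t ∈ Set.uIoc (0 : ℝ) 1, t ∈ Set.Icc (0 : ℝ) 1 := fun t ht => by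
    rw [Set.uIoc_of_le zero_le_one] at ht
    exact Set.Ioc_subset_Icc_self ht
  refine (continuousAt_of_dominated_interval (bound := fun _ => C) ?_ ?_ ?_ ?_).continuousWithinAt
  · filter_upwards [hV.mem_nhds hu] with v hv using aestronglyMeasurable_slice hF (hVO v hv)
  · filter_upwards [hs] with v hv
    exact Filter.Eventually.of_forall fun t ht => (hsC v hv t (hIcc t ht)).2
  · exact intervalIntegrable_const
  · refine Filter.Eventually.of_forall fun t ht => ?_
    have h1 : ContinuousAt F (u, t) := hF.continuousAt (hO.mem_nhds (hVO u hu t (hIcc t ht)))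
    exact ContinuousAt.comp (f := fun v => (v, t)) h1 (by fun_prop)

/-- Differentiation under the integral sign. -/
theorem hasFDerivAt_parametric_integral {E : Type*} [NormedAddCommGroup E] [NormedSpace ℝ E]
    (hV : IsOpen V) (hO : IsOpen O) (hVO : ∀ u ∈ V, ∀ t ∈ Set.Icc (0 : ℝ) 1, (u, t) ∈ O)
    {F : (Fin n → ℝ) × ℝ → E} (hF : ContDiffOn ℝ 1 F O) {u : Fin n → ℝ} (hu : u ∈ V) :
    HasFDerivAt (fun v => ∫ t in (0 : ℝ)..1, F (v, t))
      (∫ t in (0 : ℝ)..1, (fderiv ℝ F (u, t)).comp (ContinuousLinearMap.inl ℝ _ _)) u := by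
  have hF' : ContinuousOn (fun w => (fderiv ℝ F w).comp
      (ContinuousLinearMap.inl ℝ (Fin n → ℝ) ℝ)) O :=
    (hF.continuousOn_fderiv_of_isOpen hO le_rfl).clm_comp continuousOn_const
  obtain ⟨C, s, hs, hsC⟩ := exists_ball_bound hO hF' (hVO u hu)
  have hIcc : ∀ t ∈ Set.uIoc (0 : ℝ) 1, t ∈ Set.Icc (0 : ℝ) 1 := fun t ht => by
    rw [Set.uIoc_of_le zero_le_one] at ht
    exact Set.Ioc_subset_Icc_self ht
  refine hasFDerivAt_integral_of_dominated_of_fderiv_le (bound := fun _ => C)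
    (F := fun v t => F (v, t))
    (F' := fun v t => (fderiv ℝ F (v, t)).comp (ContinuousLinearMap.inl ℝ _ _))
    hs ?_ ?_ ?_ ?_ intervalIntegrable_const ?_
  · filter_upwards [hV.mem_nhds hu] with v hv
      using aestronglyMeasurable_slice hF.continuousOn (hVO v hv)
  · refine ContinuousOn.intervalIntegrable ?_
    rw [Set.uIcc_of_le zero_le_one]
    exact hF.continuousOn.comp (by fun_prop) (hVO u hu)
  · exact aestronglyMeasurable_slice hF' (hVO u hu)
  · exact Filter.Eventually.of_forall fun t ht v hv => (hsC v hv t (hIcc t ht)).2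
  · refine Filter.Eventually.of_forall fun t ht v hv => ?_
    have h1 : HasFDerivAt F (fderiv ℝ F (v, t)) (v, t) :=
      ((hF.differentiableOn one_ne_zero).differentiableAt
        (hO.mem_nhds (hsC v hv t (hIcc t ht)).1)).hasFDerivAt
    exact HasFDerivAt.comp (f := fun v => (v, t)) v h1 (hasFDerivAt_prodMk_left v t)

/-- By induction on the order: the derivative of a parametric integral is again one, with values in
a space of linear maps. -/
theorem contDiffOn_parametric_integral (hV : IsOpen V) (hO : IsOpen O)
    (hVO : ∀ u ∈ V, ∀ t ∈ Set.Icc (0 : ℝ) 1, (u, t) ∈ O) (k : ℕ) :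
    ∀ {E : Type u₀} [NormedAddCommGroup E] [NormedSpace ℝ E] {F : (Fin n → ℝ) × ℝ → E},
      ContDiffOn ℝ ∞ F O → ContDiffOn ℝ k (fun u => ∫ t in (0 : ℝ)..1, F (u, t)) V := by
  induction k with
  | zero =>
    intro E _ _ F hF
    exact contDiffOn_zero.2 (continuousOn_parametric_integral hV hO hVO hF.continuousOn)
  | succ k ih =>
    intro E _ _ F hF
    have hd := fun u (hu : u ∈ V) => hasFDerivAt_parametric_integral hV hO hVO
      (hF.of_le (by exact_mod_cast le_top)) hu
    rw [Nat.cast_succ, contDiffOn_succ_iff_fderiv_of_isOpen hV]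
    refine ⟨fun u hu => (hd u hu).differentiableAt.differentiableWithinAt, by simp, ?_⟩
    refine ContDiffOn.congr (ih (F := fun w => (fderiv ℝ F w).comp
      (ContinuousLinearMap.inl ℝ (Fin n → ℝ) ℝ)) ?_) fun u hu => (hd u hu).fderiv
    exact ((contDiffOn_infty_iff_fderiv_of_isOpen hO).1 hF).2.clm_comp contDiffOn_const

/-- **Poincaré lemma** for a closed two-form `η` on a star-shaped open set: `η = dθ`, with
`θ_β(u) = ∫₀¹ t (u - c)^α η_{αβ}(c + t (u - c)) dt`. -/
theorem exists_primitive_of_closed_twoForm {K : Type*} [NormedAddCommGroup K] [NormedSpace ℝ K]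
    [CompleteSpace K] {c : Fin n → ℝ} (hV : IsOpen V) (hc : StarConvex ℝ c V)
    {η : Fin n → Fin n → (Fin n → ℝ) → K} (hη : ∀ α β, ContDiffOn ℝ ∞ (η α β) V)
    (hskew : ∀ α β, ∀ u ∈ V, η α β u = -η β α u)
    (hclosed : ∀ α β γ, ∀ u ∈ V,
      coordDeriv α (η β γ) u + coordDeriv β (η γ α) u + coordDeriv γ (η α β) u = 0) :
    ∃ θ : Fin n → (Fin n → ℝ) → K, (∀ β, ContDiffOn ℝ ∞ (θ β) V) ∧
      ∀ α β, ∀ u ∈ V, coordDeriv α (θ β) u - coordDeriv β (θ α) u = η α β u := by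
  set ρ : (Fin n → ℝ) × ℝ → (Fin n → ℝ) := fun w => c + w.2 • (w.1 - c) with hρ
  have hρs : ContDiff ℝ ∞ ρ := by fun_prop
  set O : Set ((Fin n → ℝ) × ℝ) := ρ ⁻¹' V with hOdef
  have hO : IsOpen O := hV.preimage hρs.continuous
  have hVO : ∀ u ∈ V, ∀ t ∈ Set.Icc (0 : ℝ) 1, (u, t) ∈ O := by
    intro u hu t ht
    have := hc hu (sub_nonneg.2 ht.2) ht.1 (by ring)
    have e : ρ (u, t) = (1 - t) • c + t • u := by
      simp only [hρ, smul_sub, sub_smul, one_smul]; abel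
    rw [hOdef, Set.mem_preimage, e]
    exact this
  set F : Fin n → (Fin n → ℝ) × ℝ → K := fun β w => ∑ α, (w.2 * (w.1 α - c α)) • η α β (ρ w)
    with hFdef
  have hηρ : ∀ α β, ContDiffOn ℝ ∞ (fun w => η α β (ρ w)) O := fun α β =>
    (hη α β).comp hρs.contDiffOn fun w hw => hw
  have hF : ∀ β, ContDiffOn ℝ ∞ (F β) O := fun β => by
    refine ContDiffOn.sum fun α _ => ContDiffOn.smul ?_ (hηρ α β)
    exact ContDiff.contDiffOn (by fun_prop)
  refine ⟨fun β u => ∫ t in (0 : ℝ)..1, F β (u, t), fun β =>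
    contDiffOn_infty.2 fun k => contDiffOn_parametric_integral hV hO hVO k (hF β), ?_⟩
  -- the derivative of the integrand in the direction of a coordinate
  have hFd : ∀ γ β, ∀ w ∈ O, fderiv ℝ (F β) w (Pi.single γ 1, 0)
      = w.2 • η γ β (ρ w) + ∑ α, (w.2 ^ 2 * (w.1 α - c α)) • coordDeriv γ (η α β) (ρ w) := by
    intro γ β w hw
    have hρd : HasFDerivAt ρ (w.2 • ContinuousLinearMap.fst ℝ (Fin n → ℝ) ℝ
        + (ContinuousLinearMap.snd ℝ (Fin n → ℝ) ℝ).smulRight (w.1 - c)) w := by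
      have h1 := (hasFDerivAt_snd (𝕜 := ℝ) (p := w)).smul
        ((hasFDerivAt_fst (𝕜 := ℝ) (p := w)).sub_const c)
      exact h1.const_add c
    have hsc : ∀ α, HasFDerivAt (fun w : (Fin n → ℝ) × ℝ => w.2 * (w.1 α - c α))
        (w.2 • ((ContinuousLinearMap.proj α).comp (ContinuousLinearMap.fst ℝ (Fin n → ℝ) ℝ))
          + (w.1 α - c α) • ContinuousLinearMap.snd ℝ (Fin n → ℝ) ℝ) w := by
      intro α
      have h2 : HasFDerivAt (fun w : (Fin n → ℝ) × ℝ => w.1 α - c α)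
          ((ContinuousLinearMap.proj α).comp (ContinuousLinearMap.fst ℝ (Fin n → ℝ) ℝ)) w :=
        ((ContinuousLinearMap.proj (R := ℝ) (φ := fun _ : Fin n => ℝ) α).comp
          (ContinuousLinearMap.fst ℝ (Fin n → ℝ) ℝ)).hasFDerivAt.sub_const (c α)
      exact (hasFDerivAt_snd (𝕜 := ℝ) (p := w)).mul h2
    have hcomp : ∀ α, HasFDerivAt (fun w => η α β (ρ w)) _ w := fun α =>
      HasFDerivAt.comp w (smooth_differentiableAt hV (hη α β) hw).hasFDerivAt hρd
    have hsum : HasFDerivAt (F β) _ w :=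
      HasFDerivAt.fun_sum fun α (_ : α ∈ Finset.univ) => (hsc α).smul (hcomp α)
    rw [hsum.fderiv]
    simp only [sum_apply, add_apply, smul_apply, ContinuousLinearMap.comp_apply,
      ContinuousLinearMap.smulRight_apply, ContinuousLinearMap.coe_fst',
      ContinuousLinearMap.coe_snd', ContinuousLinearMap.proj_apply, Finset.sum_add_distrib]
    rw [add_comm]
    congr 1
    · rw [Finset.sum_eq_single γ]
      · simp
      · intro α _ hα; simp [hα]
      · simp
    · refine Finset.sum_congr rfl fun α _ => ?_
      simp only [zero_smul, add_zero, map_smul, smul_smul, coordDeriv]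
      congr 1; ring
  have hθ : ∀ γ β, ∀ u ∈ V, coordDeriv γ (fun u => ∫ t in (0 : ℝ)..1, F β (u, t)) u
      = ∫ t in (0 : ℝ)..1, fderiv ℝ (F β) (u, t) (Pi.single γ 1, 0) := by
    intro γ β u hu
    have h := hasFDerivAt_parametric_integral hV hO hVO
      ((hF β).of_le (by exact_mod_cast le_top)) hu
    rw [coordDeriv, h.fderiv, ContinuousLinearMap.intervalIntegral_apply]
    · rfl
    · refine ContinuousOn.intervalIntegrable ?_
      rw [Set.uIcc_of_le zero_le_one]
      have h3 := ((contDiffOn_infty_iff_fderiv_of_isOpen hO).1 (hF β)).2.continuousOn.clm_comp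
        (continuousOn_const (c := ContinuousLinearMap.inl ℝ (Fin n → ℝ) ℝ))
      exact h3.comp (f := fun t => (u, t)) (by fun_prop) (hVO u hu)
  intro γ β u hu
  have hint : ∀ γ β, IntervalIntegrable
      (fun t => fderiv ℝ (F β) (u, t) (Pi.single γ 1, 0)) volume 0 1 := by
    intro γ β
    refine ContinuousOn.intervalIntegrable ?_
    rw [Set.uIcc_of_le zero_le_one]
    have h3 := ((contDiffOn_infty_iff_fderiv_of_isOpen hO).1 (hF β)).2.continuousOn.clm_apply
      (continuousOn_const (c := ((Pi.single γ 1, 0) : (Fin n → ℝ) × ℝ)))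
    exact h3.comp (f := fun t => (u, t)) (by fun_prop) (hVO u hu)
  rw [hθ γ β u hu, hθ β γ u hu, ← intervalIntegral.integral_sub (hint γ β) (hint β γ)]
  -- closedness turns the integrand into the derivative of `t² η_{γβ}(c + t (u - c))`
  have hder : ∀ t ∈ Set.uIcc (0 : ℝ) 1, HasDerivAt (fun t : ℝ => t ^ 2 • η γ β (ρ (u, t)))
      (fderiv ℝ (F β) (u, t) (Pi.single γ 1, 0) - fderiv ℝ (F γ) (u, t) (Pi.single β 1, 0)) t := by
    intro t ht
    rw [Set.uIcc_of_le zero_le_one] at ht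
    have hw := hVO u hu t ht
    have hline : HasDerivAt (fun t : ℝ => ρ (u, t)) (u - c) t := by
      have h0 := ((hasDerivAt_id t).smul_const (u - c)).const_add c
      rwa [one_smul] at h0
    have h1 := (smooth_differentiableAt hV (hη γ β) hw).hasFDerivAt.comp_hasDerivAt t hline
    have h2 := (hasDerivAt_pow 2 t).smul h1
    refine h2.congr_deriv ?_
    rw [hFd γ β _ hw, hFd β γ _ hw, fderiv_eq_sum_coordDeriv, hskew β γ _ hw,
      add_sub_add_comm, ← Finset.sum_sub_distrib, Finset.smul_sum, add_comm]
    congr 1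
    · simp only [smul_neg, sub_neg_eq_add, ← two_smul ℝ, smul_smul]
      norm_num
    · refine Finset.sum_congr rfl fun α _ => ?_
      have h4 := hclosed α γ β _ hw
      have h5 : coordDeriv γ (η β α) (ρ (u, t)) = -coordDeriv γ (η α β) (ρ (u, t)) := by
        rw [coordDeriv_congr hV (fun v hv => hskew β α v hv) γ hw, coordDeriv_neg]
      rw [h5] at h4
      rw [← smul_sub, smul_smul]
      congr 1
      rw [← sub_eq_zero, ← h4]
      abel
  rw [intervalIntegral.integral_eq_sub_of_hasDerivAt hder ((hint γ β).sub (hint β γ))]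
  simp [hρ]

end Poincare

/-! ### Total derivatives of functions of the first jet -/

section Jets

variable {n : ℕ} {E : Type*} [NormedAddCommGroup E] [NormedSpace ℝ E] {Ω : Set (Fin n → ℝ)}

theorem hasDerivAt_jet (z v : JetSpace n) (i j : ℕ) (α : Fin n) :
    HasDerivAt (fun t : ℝ => jet (z + t • v) i j α) (jet v i j α) 0 := by
  have h := ((hasDerivAt_id (0 : ℝ)).mul_const (jet v i j α)).const_add (jet z i j α)
  rwa [one_mul] at h

theorem hasDerivAt_fieldValue {X : (Fin n → ℝ) → E} (hΩ : IsOpen Ω) (hX : ContDiffOn ℝ ∞ X Ω)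
    {z : JetSpace n} (hz : fieldValue z ∈ Ω) (v : JetSpace n) :
    HasDerivAt (fun t : ℝ => X (fieldValue (z + t • v)))
      (∑ α, jet v 0 0 α • coordDeriv α X (fieldValue z)) 0 := by
  have hline : HasDerivAt (fun t : ℝ => fieldValue (z + t • v)) (jet v 0 0) 0 := by
    have h := ((hasDerivAt_id (0 : ℝ)).smul_const (jet v 0 0)).const_add (jet z 0 0)
    rwa [one_smul] at h
  have h0 : fieldValue (z + (0 : ℝ) • v) = fieldValue z := by rw [zero_smul, add_zero]
  have h1 := (smooth_differentiableAt hΩ hX (u := fieldValue (z + (0 : ℝ) • v))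
    (by rwa [h0])).hasFDerivAt.comp_hasDerivAt (0 : ℝ) hline
  refine h1.congr_deriv ?_
  rw [fderiv_eq_sum_coordDeriv, h0]

theorem hasDerivAt_jet_smul {X : (Fin n → ℝ) → E} (hΩ : IsOpen Ω) (hX : ContDiffOn ℝ ∞ X Ω)
    {z : JetSpace n} (hz : fieldValue z ∈ Ω) (v : JetSpace n) (i j : ℕ) (α : Fin n) :
    HasDerivAt (fun t : ℝ => jet (z + t • v) i j α • X (fieldValue (z + t • v)))
      (jet v i j α • X (fieldValue z)
        + ∑ β, (jet z i j α * jet v 0 0 β) • coordDeriv β X (fieldValue z)) 0 := by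
  refine ((hasDerivAt_jet z v i j α).smul (hasDerivAt_fieldValue hΩ hX hz v)).congr_deriv ?_
  rw [add_comm]
  simp only [zero_smul, add_zero, Finset.smul_sum, smul_smul]

theorem hasDerivAt_sum_jet_smul {X : Fin n → (Fin n → ℝ) → E} (hΩ : IsOpen Ω)
    (hX : ∀ α, ContDiffOn ℝ ∞ (X α) Ω) {z : JetSpace n} (hz : fieldValue z ∈ Ω)
    (v : JetSpace n) (i j : ℕ) :
    HasDerivAt (fun t : ℝ => ∑ α, jet (z + t • v) i j α • X α (fieldValue (z + t • v)))
      (∑ α, jet v i j α • X α (fieldValue z)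
        + ∑ α, ∑ β, (jet z i j α * jet v 0 0 β) • coordDeriv β (X α) (fieldValue z)) 0 := by
  refine (HasDerivAt.fun_sum fun α (_ : α ∈ Finset.univ) =>
    hasDerivAt_jet_smul hΩ (hX α) hz v i j α).congr_deriv ?_
  rw [Finset.sum_add_distrib]

/-- The direction of the total derivative `D_x`. -/
abbrev dirX (z : JetSpace n) : JetSpace n := ((1 : ℝ), (0 : ℝ), fun i j => jet z (i + 1) j)

/-- The direction of the total derivative `D_y`. -/
abbrev dirY (z : JetSpace n) : JetSpace n := ((0 : ℝ), (1 : ℝ), fun i j => jet z i (j + 1))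

/-- The direction of the coordinate `u^α_{i,j}`. -/
abbrev dirJet (i j : ℕ) (α : Fin n) : JetSpace n :=
  ((0 : ℝ), (0 : ℝ), Pi.single i (Pi.single j (Pi.single α (1 : ℝ))))

theorem Dy_fieldValue {X : (Fin n → ℝ) → E} (hΩ : IsOpen Ω) (hX : ContDiffOn ℝ ∞ X Ω)
    {z : JetSpace n} (hz : fieldValue z ∈ Ω) :
    Dy (fun w => X (fieldValue w)) z = ∑ α, jet z 0 1 α • coordDeriv α X (fieldValue z) :=
  (hasDerivAt_fieldValue hΩ hX hz (dirY z)).deriv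

theorem hasDerivAt_sum_Uy {X : Fin n → (Fin n → ℝ) → E} (hΩ : IsOpen Ω)
    (hX : ∀ α, ContDiffOn ℝ ∞ (X α) Ω) {z : JetSpace n} (hz : fieldValue z ∈ Ω) :
    HasDerivAt (fun t : ℝ => ∑ α, jet (z + t • dirX z) 0 1 α • X α (fieldValue (z + t • dirX z)))
      (∑ γ, jet z 1 1 γ • X γ (fieldValue z)
      + ∑ β, ∑ γ, (jet z 1 0 β * jet z 0 1 γ) • coordDeriv β (X γ) (fieldValue z)) 0 := by
  refine (hasDerivAt_sum_jet_smul hΩ hX hz (dirX z) 0 1).congr_deriv ?_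
  rw [Finset.sum_comm]
  simp only [mul_comm (jet z 0 1 _)]
  rfl

theorem hasDerivAt_sum_Ux {X : Fin n → (Fin n → ℝ) → E} (hΩ : IsOpen Ω)
    (hX : ∀ α, ContDiffOn ℝ ∞ (X α) Ω) {z : JetSpace n} (hz : fieldValue z ∈ Ω) :
    HasDerivAt (fun t : ℝ => ∑ α, jet (z + t • dirY z) 1 0 α • X α (fieldValue (z + t • dirY z)))
      (∑ β, jet z 1 1 β • X β (fieldValue z)
      + ∑ β, ∑ γ, (jet z 1 0 β * jet z 0 1 γ) • coordDeriv γ (X β) (fieldValue z)) 0 :=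
  hasDerivAt_sum_jet_smul hΩ hX hz (dirY z) 1 0

theorem Dx_sum_Uy {X : Fin n → (Fin n → ℝ) → E} (hΩ : IsOpen Ω)
    (hX : ∀ α, ContDiffOn ℝ ∞ (X α) Ω) {z : JetSpace n} (hz : fieldValue z ∈ Ω) :
    Dx (fun w => ∑ γ, jet w 0 1 γ • X γ (fieldValue w)) z = ∑ γ, jet z 1 1 γ • X γ (fieldValue z)
      + ∑ β, ∑ γ, (jet z 1 0 β * jet z 0 1 γ) • coordDeriv β (X γ) (fieldValue z) :=
  (hasDerivAt_sum_Uy hΩ hX hz).deriv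

theorem Dy_sum_Ux {X : Fin n → (Fin n → ℝ) → E} (hΩ : IsOpen Ω)
    (hX : ∀ α, ContDiffOn ℝ ∞ (X α) Ω) {z : JetSpace n} (hz : fieldValue z ∈ Ω) :
    Dy (fun w => ∑ β, jet w 1 0 β • X β (fieldValue w)) z = ∑ β, jet z 1 1 β • X β (fieldValue z)
      + ∑ β, ∑ γ, (jet z 1 0 β * jet z 0 1 γ) • coordDeriv γ (X β) (fieldValue z) :=
  (hasDerivAt_sum_Ux hΩ hX hz).deriv

/-- Adding a function of the dependent variables to a first-order function. -/
theorem Dx_sum_Uy_add {X : Fin n → (Fin n → ℝ) → E} {Y : (Fin n → ℝ) → E} (hΩ : IsOpen Ω)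
    (hX : ∀ α, ContDiffOn ℝ ∞ (X α) Ω) (hY : ContDiffOn ℝ ∞ Y Ω)
    {z : JetSpace n} (hz : fieldValue z ∈ Ω) :
    Dx (fun w => ∑ γ, jet w 0 1 γ • X γ (fieldValue w) + Y (fieldValue w)) z
      = ∑ γ, jet z 1 1 γ • X γ (fieldValue z)
      + ∑ β, ∑ γ, (jet z 1 0 β * jet z 0 1 γ) • coordDeriv β (X γ) (fieldValue z)
      + ∑ α, jet z 1 0 α • coordDeriv α Y (fieldValue z) :=
  ((hasDerivAt_sum_Uy hΩ hX hz).add (hasDerivAt_fieldValue hΩ hY hz (dirX z))).deriv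

theorem Dy_sum_Ux_add {X : Fin n → (Fin n → ℝ) → E} {Y : (Fin n → ℝ) → E} (hΩ : IsOpen Ω)
    (hX : ∀ α, ContDiffOn ℝ ∞ (X α) Ω) (hY : ContDiffOn ℝ ∞ Y Ω)
    {z : JetSpace n} (hz : fieldValue z ∈ Ω) :
    Dy (fun w => ∑ β, jet w 1 0 β • X β (fieldValue w) + Y (fieldValue w)) z
      = ∑ β, jet z 1 1 β • X β (fieldValue z)
      + ∑ β, ∑ γ, (jet z 1 0 β * jet z 0 1 γ) • coordDeriv γ (X β) (fieldValue z)
      + ∑ α, jet z 0 1 α • coordDeriv α Y (fieldValue z) :=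
  ((hasDerivAt_sum_Ux hΩ hX hz).add (hasDerivAt_fieldValue hΩ hY hz (dirY z))).deriv

/-! ### Locality of the differential operators -/

theorem deriv_line_congr {P P' : JetSpace n → E} (hΩ : IsOpen Ω)
    (h : ∀ z, fieldValue z ∈ Ω → P z = P' z) {z : JetSpace n} (hz : fieldValue z ∈ Ω)
    (v : JetSpace n) :
    deriv (fun t : ℝ => P (z + t • v)) 0 = deriv (fun t : ℝ => P' (z + t • v)) 0 := by
  refine Filter.EventuallyEq.deriv_eq ?_
  have hc : ContinuousAt (fun t : ℝ => fieldValue (z + t • v)) 0 := by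
    have : (fun t : ℝ => fieldValue (z + t • v)) = fun t => jet z 0 0 + t • jet v 0 0 := rfl
    rw [this]; fun_prop
  have hmem : Ω ∈ nhds (fieldValue (z + (0 : ℝ) • v)) := by
    rw [zero_smul, add_zero]; exact hΩ.mem_nhds hz
  filter_upwards [hc hmem] with t ht using h _ ht

theorem Dx_congr {P P' : JetSpace n → E} (hΩ : IsOpen Ω)
    (h : ∀ z, fieldValue z ∈ Ω → P z = P' z) {z : JetSpace n} (hz : fieldValue z ∈ Ω) :
    Dx P z = Dx P' z := deriv_line_congr hΩ h hz _

theorem Dy_congr {P P' : JetSpace n → E} (hΩ : IsOpen Ω)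
    (h : ∀ z, fieldValue z ∈ Ω → P z = P' z) {z : JetSpace n} (hz : fieldValue z ∈ Ω) :
    Dy P z = Dy P' z := deriv_line_congr hΩ h hz _

theorem jetPartial_congr {P P' : JetSpace n → E} (hΩ : IsOpen Ω)
    (h : ∀ z, fieldValue z ∈ Ω → P z = P' z) (i j : ℕ) (α : Fin n) {z : JetSpace n}
    (hz : fieldValue z ∈ Ω) : jetPartial i j α P z = jetPartial i j α P' z :=
  deriv_line_congr hΩ h hz _

/-- Smoothness is not needed here: the lines along which `Dx` and `Dy` differentiate stay over the
open set `Ω` for a short time. -/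
theorem iterate_Dx_Dy_congr {P P' : JetSpace n → E} (hΩ : IsOpen Ω)
    (h : ∀ z, fieldValue z ∈ Ω → P z = P' z) (i j : ℕ) :
    ∀ z : JetSpace n, fieldValue z ∈ Ω → Dx^[i] (Dy^[j] P) z = Dx^[i] (Dy^[j] P') z := by
  have hy : ∀ z : JetSpace n, fieldValue z ∈ Ω → Dy^[j] P z = Dy^[j] P' z := by
    induction j with
    | zero => exact h
    | succ j ih =>
      intro z hz
      rw [Function.iterate_succ_apply', Function.iterate_succ_apply', Dy_congr hΩ ih hz]
  induction i with
  | zero => exact hy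
  | succ i ih =>
    intro z hz
    rw [Function.iterate_succ_apply', Function.iterate_succ_apply', Dx_congr hΩ ih hz]

theorem iterate_Dx_Dy_eq_zero {P : JetSpace n → E} (hΩ : IsOpen Ω)
    (h : ∀ z, fieldValue z ∈ Ω → P z = 0) (i j : ℕ) {z : JetSpace n} (hz : fieldValue z ∈ Ω) :
    Dx^[i] (Dy^[j] P) z = 0 := by
  have hx : Dx (fun _ : JetSpace n => (0 : E)) = fun _ => 0 := funext fun _ => deriv_const _ _
  have hy : Dy (fun _ : JetSpace n => (0 : E)) = fun _ => 0 := funext fun _ => deriv_const _ _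
  rw [iterate_Dx_Dy_congr hΩ h i j z hz, Function.iterate_fixed hy, Function.iterate_fixed hx]

theorem euler_congr {P P' : JetSpace n → E} (hΩ : IsOpen Ω)
    (h : ∀ z, fieldValue z ∈ Ω → P z = P' z) (α : Fin n) {z : JetSpace n}
    (hz : fieldValue z ∈ Ω) : euler α P z = euler α P' z :=
  finsum_congr fun J => by
    rw [iterate_Dx_Dy_congr hΩ (fun _ hw => jetPartial_congr hΩ h J.1 J.2 α hw) _ _ z hz]

/-! ### The Euler operator on quasilinear second-order functions -/

/-- The function `r_γ U^γ_{xy} + h_{βγ} U^β_x U^γ_y`, for functions `r_γ, h_{βγ}` of the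
dependent variables. -/
def quasilinear (r : Fin n → (Fin n → ℝ) → E) (h : Fin n → Fin n → (Fin n → ℝ) → E)
    (z : JetSpace n) : E :=
  ∑ γ, jet z 1 1 γ • r γ (fieldValue z)
    + ∑ β, ∑ γ, (jet z 1 0 β * jet z 0 1 γ) • h β γ (fieldValue z)

variable {r : Fin n → (Fin n → ℝ) → E} {h : Fin n → Fin n → (Fin n → ℝ) → E}

/-- The common formula behind the individual partial derivatives; the direction `v` is a variable so
that its coordinates can be simplified afterwards. -/
theorem jetPartial_quasilinear (hΩ : IsOpen Ω) (hr : ∀ α, ContDiffOn ℝ ∞ (r α) Ω)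
    (hh : ∀ α β, ContDiffOn ℝ ∞ (h α β) Ω) {z : JetSpace n} (hz : fieldValue z ∈ Ω)
    (i j : ℕ) (α : Fin n) {v : JetSpace n} (hv : v = dirJet i j α) :
    jetPartial i j α (quasilinear r h) z
      = (∑ γ, jet v 1 1 γ • r γ (fieldValue z)
        + ∑ γ, ∑ δ, (jet z 1 1 γ * jet v 0 0 δ) • coordDeriv δ (r γ) (fieldValue z))
      + ∑ β, ∑ γ, ((jet v 1 0 β * jet z 0 1 γ + jet z 1 0 β * jet v 0 1 γ) • h β γ (fieldValue z)
        + (jet z 1 0 β * jet z 0 1 γ) •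
          ∑ δ, jet v 0 0 δ • coordDeriv δ (h β γ) (fieldValue z)) := by
  subst hv
  have h1 := hasDerivAt_sum_jet_smul hΩ hr hz (dirJet i j α) 1 1
  have h2 : ∀ β γ, HasDerivAt (fun t : ℝ => (jet (z + t • dirJet i j α) 1 0 β *
      jet (z + t • dirJet i j α) 0 1 γ) • h β γ (fieldValue (z + t • dirJet i j α)))
      ((jet (dirJet i j α) 1 0 β * jet z 0 1 γ + jet z 1 0 β * jet (dirJet i j α) 0 1 γ) •
          h β γ (fieldValue z)
        + (jet z 1 0 β * jet z 0 1 γ) •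
          ∑ δ, jet (dirJet i j α) 0 0 δ • coordDeriv δ (h β γ) (fieldValue z)) 0 := by
    intro β γ
    have h3 := ((hasDerivAt_jet z (dirJet i j α) 1 0 β).mul
      (hasDerivAt_jet z (dirJet i j α) 0 1 γ)).smul
      (hasDerivAt_fieldValue hΩ (hh β γ) hz (dirJet i j α))
    refine h3.congr_deriv ?_
    rw [add_comm]
    simp only [zero_smul, add_zero, Pi.mul_apply]
  exact (h1.add (HasDerivAt.fun_sum fun β (_ : β ∈ Finset.univ) =>
    HasDerivAt.fun_sum fun γ (_ : γ ∈ Finset.univ) => h2 β γ)).deriv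

theorem jet_dirJet_self (i j : ℕ) (α β : Fin n) :
    jet (dirJet i j α) i j β = if β = α then 1 else 0 := by
  simp [jet, Pi.single_apply]

theorem jet_dirJet_of_ne {i j k l : ℕ} (hne : ¬ (k = i ∧ l = j)) (α β : Fin n) :
    jet (dirJet i j α) k l β = 0 := by
  by_cases hk : k = i
  · subst hk
    have hl : l ≠ j := fun hl => hne ⟨rfl, hl⟩
    simp [jet, hl]
  · simp [jet, hk]

theorem jetPartial_quasilinear_zero_zero (hΩ : IsOpen Ω) (hr : ∀ α, ContDiffOn ℝ ∞ (r α) Ω)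
    (hh : ∀ α β, ContDiffOn ℝ ∞ (h α β) Ω) {z : JetSpace n} (hz : fieldValue z ∈ Ω)
    (α : Fin n) : jetPartial 0 0 α (quasilinear r h) z
      = ∑ γ, jet z 1 1 γ • coordDeriv α (r γ) (fieldValue z)
      + ∑ β, ∑ γ, (jet z 1 0 β * jet z 0 1 γ) • coordDeriv α (h β γ) (fieldValue z) := by
  rw [jetPartial_quasilinear hΩ hr hh hz 0 0 α rfl]
  simp [jet_dirJet_self, jet_dirJet_of_ne]

theorem jetPartial_quasilinear_one_zero (hΩ : IsOpen Ω) (hr : ∀ α, ContDiffOn ℝ ∞ (r α) Ω)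
    (hh : ∀ α β, ContDiffOn ℝ ∞ (h α β) Ω) {z : JetSpace n} (hz : fieldValue z ∈ Ω)
    (α : Fin n) : jetPartial 1 0 α (quasilinear r h) z
      = ∑ γ, jet z 0 1 γ • h α γ (fieldValue z) := by
  rw [jetPartial_quasilinear hΩ hr hh hz 1 0 α rfl]
  simp [jet_dirJet_self, jet_dirJet_of_ne, Finset.sum_ite_irrel]

theorem jetPartial_quasilinear_zero_one (hΩ : IsOpen Ω) (hr : ∀ α, ContDiffOn ℝ ∞ (r α) Ω)
    (hh : ∀ α β, ContDiffOn ℝ ∞ (h α β) Ω) {z : JetSpace n} (hz : fieldValue z ∈ Ω)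
    (α : Fin n) : jetPartial 0 1 α (quasilinear r h) z
      = ∑ β, jet z 1 0 β • h β α (fieldValue z) := by
  rw [jetPartial_quasilinear hΩ hr hh hz 0 1 α rfl]
  simp [jet_dirJet_self, jet_dirJet_of_ne]

theorem jetPartial_quasilinear_one_one (hΩ : IsOpen Ω) (hr : ∀ α, ContDiffOn ℝ ∞ (r α) Ω)
    (hh : ∀ α β, ContDiffOn ℝ ∞ (h α β) Ω) {z : JetSpace n} (hz : fieldValue z ∈ Ω)
    (α : Fin n) : jetPartial 1 1 α (quasilinear r h) z = r α (fieldValue z) := by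
  rw [jetPartial_quasilinear hΩ hr hh hz 1 1 α rfl]
  simp [jet_dirJet_self, jet_dirJet_of_ne]

theorem jetPartial_quasilinear_eq_zero (hΩ : IsOpen Ω) (hr : ∀ α, ContDiffOn ℝ ∞ (r α) Ω)
    (hh : ∀ α β, ContDiffOn ℝ ∞ (h α β) Ω) {z : JetSpace n} (hz : fieldValue z ∈ Ω)
    {i j : ℕ} (hij : ¬ (i < 2 ∧ j < 2)) (α : Fin n) :
    jetPartial i j α (quasilinear r h) z = 0 := by
  rw [jetPartial_quasilinear hΩ hr hh hz i j α rfl]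
  have h0 : ∀ k l : ℕ, k < 2 → l < 2 → ¬ (k = i ∧ l = j) := fun k l hk hl => by
    rintro ⟨rfl, rfl⟩; exact hij ⟨hk, hl⟩
  simp [jet_dirJet_of_ne (h0 0 0 (by simp) (by simp)),
    jet_dirJet_of_ne (h0 1 0 (by simp) (by simp)),
    jet_dirJet_of_ne (h0 0 1 (by simp) (by simp)), jet_dirJet_of_ne (h0 1 1 (by simp) (by simp))]

/-- The Euler operators annihilate `r_γ U^γ_{xy} + h_{βγ} U^β_x U^γ_y` as soon as two identities
hold among the first derivatives of `h` and the second derivatives of `r`. -/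
theorem euler_quasilinear_eq_zero (hΩ : IsOpen Ω) (hr : ∀ α, ContDiffOn ℝ ∞ (r α) Ω)
    (hh : ∀ α β, ContDiffOn ℝ ∞ (h α β) Ω)
    (h1 : ∀ α γ, ∀ u ∈ Ω, h α γ u + h γ α u = coordDeriv α (r γ) u + coordDeriv γ (r α) u)
    (h2 : ∀ α β γ, ∀ u ∈ Ω, coordDeriv α (h β γ) u - coordDeriv β (h α γ) u
      - coordDeriv γ (h β α) u + coordDeriv β (coordDeriv γ (r α)) u = 0)
    (α : Fin n) {z : JetSpace n} (hz : fieldValue z ∈ Ω) :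
    euler α (quasilinear r h) z = 0 := by
  have hsupp : (Function.support fun J : ℕ × ℕ => (-1 : ℝ) ^ (J.1 + J.2) •
      Dx^[J.1] (Dy^[J.2] (jetPartial J.1 J.2 α (quasilinear r h))) z)
      ⊆ ↑(Finset.range 2 ×ˢ Finset.range 2) := by
    intro J hJ
    by_contra hne
    refine hJ ?_
    have hne' : ¬ (J.1 < 2 ∧ J.2 < 2) := by simpa using hne
    change _ • _ = _
    rw [iterate_Dx_Dy_eq_zero hΩ
      (fun w hw => jetPartial_quasilinear_eq_zero hΩ hr hh hw hne' α) _ _ hz, smul_zero]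
  rw [euler, finsum_eq_sum_of_support_subset _ hsupp, Finset.sum_product]
  simp only [Finset.sum_range_succ, Finset.sum_range_zero, zero_add, Function.iterate_zero,
    Function.iterate_one, id_eq, pow_zero, pow_one, add_zero, one_smul, neg_smul]
  have e11 : ∀ w : JetSpace n, fieldValue w ∈ Ω → Dy (jetPartial 1 1 α (quasilinear r h)) w
      = ∑ γ, jet w 0 1 γ • coordDeriv γ (r α) (fieldValue w) := fun w hw => by
    rw [Dy_congr hΩ (fun v hv => jetPartial_quasilinear_one_one hΩ hr hh hv α) hw,
      Dy_fieldValue hΩ (hr α) hw]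
  rw [Dx_congr hΩ e11 hz, Dx_sum_Uy hΩ (fun γ => smooth_coordDeriv hΩ (hr α) γ) hz,
    jetPartial_quasilinear_zero_zero hΩ hr hh hz,
    Dy_congr hΩ (fun v hv => jetPartial_quasilinear_zero_one hΩ hr hh hv α) hz,
    Dy_sum_Ux hΩ (fun β => hh β α) hz,
    Dx_congr hΩ (fun v hv => jetPartial_quasilinear_one_zero hΩ hr hh hv α) hz,
    Dx_sum_Uy hΩ (fun β => hh α β) hz]
  have k1 : ∑ γ, jet z 1 1 γ • coordDeriv α (r γ) (fieldValue z)
      - ∑ γ, jet z 1 1 γ • h γ α (fieldValue z) - ∑ γ, jet z 1 1 γ • h α γ (fieldValue z)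
      + ∑ γ, jet z 1 1 γ • coordDeriv γ (r α) (fieldValue z) = 0 := by
    simp only [← Finset.sum_sub_distrib, ← Finset.sum_add_distrib, ← smul_sub, ← smul_add]
    refine Finset.sum_eq_zero fun γ _ => ?_
    have := h1 α γ _ hz
    rw [sub_sub, add_comm (h γ α _), this]
    simp
  have k2 : ∑ β, ∑ γ, (jet z 1 0 β * jet z 0 1 γ) • coordDeriv α (h β γ) (fieldValue z)
      - ∑ β, ∑ γ, (jet z 1 0 β * jet z 0 1 γ) • coordDeriv β (h α γ) (fieldValue z)
      - ∑ β, ∑ γ, (jet z 1 0 β * jet z 0 1 γ) • coordDeriv γ (h β α) (fieldValue z)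
      + ∑ β, ∑ γ, (jet z 1 0 β * jet z 0 1 γ) •
        coordDeriv β (coordDeriv γ (r α)) (fieldValue z) = 0 := by
    simp only [← Finset.sum_sub_distrib, ← Finset.sum_add_distrib, ← smul_sub, ← smul_add]
    refine Finset.sum_eq_zero fun β _ => Finset.sum_eq_zero fun γ _ => ?_
    rw [h2 α β γ _ hz, smul_zero]
  have k3 := congrArg₂ (· + ·) k1 k2
  simp only [add_zero] at k3
  rw [← k3]
  norm_num
  abel

end Jets

/-! ### Invariant forms on a normed Lie algebra -/

section InvariantForm

variable {n q : ℕ} {W K : Type*} [NormedAddCommGroup W] [NormedSpace ℝ W]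
  [NormedAddCommGroup K] [NormedSpace ℝ K]

/-- The continuous bilinear map `br` is a Lie bracket. A bracket given as a map, rather than by a
`LieRing` instance, can live on a normed space without a second additive structure. -/
structure IsLieBracket (br : W →L[ℝ] W →L[ℝ] W) : Prop where
  skew : ∀ x y, br x y = -br y x
  leibniz : ∀ x y z, br x (br y z) = br (br x y) z + br y (br x z)

variable {br : W →L[ℝ] W →L[ℝ] W} {f : ContinuousMultilinearMap ℝ (fun _ : Fin (q + 1) => W) K}

/-- The number `f(X, Y, …, Y)`. -/
def formValue (f : ContinuousMultilinearMap ℝ (fun _ : Fin (q + 1) => W) K) (X Y : W) : K :=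
  f (Fin.cons X fun _ => Y)

/-- Ad-invariance of `f` with respect to the bracket `br`. -/
def IsInvariant (br : W →L[ℝ] W →L[ℝ] W)
    (f : ContinuousMultilinearMap ℝ (fun _ : Fin (q + 1) => W) K) : Prop :=
  ∀ (y : W) (x : Fin (q + 1) → W), ∑ i, f (Function.update x i (br y (x i))) = 0

theorem formValue_eq_toContinuousLinearMap (X Y : W) :
    formValue f X Y = f.toContinuousLinearMap (Fin.cons 0 fun _ => Y) 0 X := by
  simp [formValue]

theorem formValue_add (X X' Y : W) :
    formValue f (X + X') Y = formValue f X Y + formValue f X' Y := by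
  simp only [formValue_eq_toContinuousLinearMap, map_add]

theorem formValue_sub (X X' Y : W) :
    formValue f (X - X') Y = formValue f X Y - formValue f X' Y := by
  simp only [formValue_eq_toContinuousLinearMap, map_sub]

theorem formValue_neg (X Y : W) : formValue f (-X) Y = -formValue f X Y := by
  simp only [formValue_eq_toContinuousLinearMap, map_neg]

theorem formValue_sum_smul {ι : Type*} (s : Finset ι) (c : ι → ℝ) (X : ι → W) (Y : W) :
    formValue f (∑ i ∈ s, c i • X i) Y = ∑ i ∈ s, c i • formValue f (X i) Y := by
  simp only [formValue_eq_toContinuousLinearMap, map_sum, map_smul]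

/-- If `F` commutes with `Y`, then `f([F, X], Y, …, Y) = 0`. -/
theorem formValue_bracket_eq_zero_of_commute (hinv : IsInvariant br f) {F X Y : W}
    (hF : br F Y = 0) : formValue f (br F X) Y = 0 := by
  have h := hinv F (Fin.cons X fun _ => Y)
  rw [Fin.sum_univ_succ, Finset.sum_eq_zero, add_zero] at h
  · simpa [formValue] using h
  · intro i _
    simp only [Fin.cons_succ, hF]
    exact f.map_coord_zero i.succ (by simp)

/-- For a symmetric invariant form, `f([y, Y], Y, …, Y) = 0`: all terms of the invariance identity
at `(Y, …, Y)` agree. -/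
theorem formValue_bracket_self (hinv : IsInvariant br f)
    (hsymm : ∀ (σ : Equiv.Perm (Fin (q + 1))) (x : Fin (q + 1) → W), f (fun i => x (σ i)) = f x)
    (y Y : W) : formValue f (br y Y) Y = 0 := by
  have h := hinv y (fun _ => Y)
  have hterm : ∀ i : Fin (q + 1), f (Function.update (fun _ => Y) i (br y Y))
      = formValue f (br y Y) Y := by
    intro i
    rw [← hsymm (Equiv.swap 0 i), formValue]
    congr 1
    funext j
    refine Fin.cases ?_ (fun j => ?_) j
    · simp
    · rw [Fin.cons_succ, Function.update_of_ne]
      intro hj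
      have := congrArg (Equiv.swap 0 i) hj
      simp at this
  simp only [hterm, Finset.sum_const, Finset.card_univ, Fintype.card_fin,
    ← Nat.cast_smul_eq_nsmul ℝ] at h
  exact (smul_eq_zero.1 h).resolve_left (Nat.cast_ne_zero.2 (Nat.succ_ne_zero q))

variable {Ω : Set (Fin n → ℝ)}

theorem smooth_formValue {X Y : (Fin n → ℝ) → W} (hX : ContDiffOn ℝ ∞ X Ω)
    (hY : ContDiffOn ℝ ∞ Y Ω) : ContDiffOn ℝ ∞ (fun u => formValue f (X u) (Y u)) Ω := by
  refine f.contDiff.comp_contDiffOn (contDiffOn_pi.2 fun i => ?_)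
  refine Fin.cases ?_ (fun j => ?_) i
  · simpa using hX
  · simpa using hY

/-- The covariant Leibniz rule: if `∂Y = [b, Y]`, then differentiating `f(X, Y, …, Y)` amounts to
differentiating `X` covariantly. -/
theorem coordDeriv_formValue (hinv : IsInvariant br f) {X Y : (Fin n → ℝ) → W} {u : Fin n → ℝ}
    (hX : DifferentiableAt ℝ X u) (hY : DifferentiableAt ℝ Y u) {α : Fin n} {b : W}
    (hb : coordDeriv α Y u = br b (Y u)) :
    coordDeriv α (fun v => formValue f (X v) (Y v)) u
      = formValue f (coordDeriv α X u - br b (X u)) (Y u) := by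
  have hg : ∀ i : Fin (q + 1), HasFDerivAt
      (fun v => (Fin.cons (X v) fun _ => Y v : Fin (q + 1) → W) i)
      ((Fin.cons (fderiv ℝ X u) fun _ => fderiv ℝ Y u : Fin (q + 1) → (Fin n → ℝ) →L[ℝ] W) i)
      u := by
    intro i
    refine Fin.cases ?_ (fun j => ?_) i
    · simpa using hX.hasFDerivAt
    · simpa using hY.hasFDerivAt
  have hf : HasFDerivAt (fun v => formValue f (X v) (Y v)) _ u := HasFDerivAt.multilinear_comp f hg
  have h := hinv b (Fin.cons (X u) fun _ => Y u)
  rw [coordDeriv, hf.fderiv, formValue_sub]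
  rw [Fin.sum_univ_succ] at h ⊢
  have e0 : formValue f (br b (X u)) (Y u) = f (Function.update
      (Fin.cons (X u) fun _ => Y u : Fin (q + 1) → W) 0 (br b (X u))) := by
    simp [formValue]
  have e1 := eq_neg_of_add_eq_zero_left h
  simp only [Fin.cons_zero, Fin.cons_succ] at e1
  rw [e0, e1]
  simp only [sub_neg_eq_add, add_apply, sum_apply, ContinuousLinearMap.comp_apply,
    ContinuousMultilinearMap.toContinuousLinearMap_apply, Fin.cons_zero, Fin.cons_succ, ← hb]
  congr 1
  simp [formValue, coordDeriv]

end InvariantForm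

/-! ### The coefficient identities of a Lax representation -/

section LaxCoefficients

variable {n q : ℕ} {W K : Type*} [NormedAddCommGroup W] [NormedSpace ℝ W]
  [NormedAddCommGroup K] [NormedSpace ℝ K] {Ω : Set (Fin n → ℝ)}
  {br : W →L[ℝ] W →L[ℝ] W}
  {G : Fin n → Fin n → Fin n → (Fin n → ℝ) → ℝ} {Q : Fin n → (Fin n → ℝ) → ℝ}
  {A B S : Fin n → (Fin n → ℝ) → W} {M N : (Fin n → ℝ) → W}

/-- The coefficients of `U_{xy}`, `U_x U_y`, `U_y`, `U_x` and `1` in the Lax identity. -/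
structure LaxCoefficients (Ω : Set (Fin n → ℝ)) (br : W →L[ℝ] W →L[ℝ] W)
    (G : Fin n → Fin n → Fin n → (Fin n → ℝ) → ℝ) (Q : Fin n → (Fin n → ℝ) → ℝ)
    (A B : Fin n → (Fin n → ℝ) → W) (M N : (Fin n → ℝ) → W) (S : Fin n → (Fin n → ℝ) → W) :
    Prop where
  smooth_A : ∀ α, ContDiffOn ℝ ∞ (A α) Ω
  smooth_B : ∀ α, ContDiffOn ℝ ∞ (B α) Ω
  smooth_M : ContDiffOn ℝ ∞ M Ω
  smooth_N : ContDiffOn ℝ ∞ N Ω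
  char_eq : ∀ α, ∀ u ∈ Ω, S α u = A α u - B α u
  curvature : ∀ α β, ∀ u ∈ Ω, coordDeriv β (A α) u - coordDeriv α (B β) u + br (A α u) (B β u)
    = ∑ γ, G γ α β u • S γ u
  deriv_M : ∀ β, ∀ u ∈ Ω, coordDeriv β M u = br (B β u) (M u)
  deriv_N : ∀ α, ∀ u ∈ Ω, coordDeriv α N u = br (A α u) (N u)
  bracket_MN : ∀ u ∈ Ω, br (M u) (N u) = ∑ α, Q α u • S α u

/-- Interchanging `x` and `y` interchanges `A, M` with `B, N` and changes the sign of `S`. -/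
theorem LaxCoefficients.swap (hbr : IsLieBracket br) (hL : LaxCoefficients Ω br G Q A B M N S) :
    LaxCoefficients Ω br (fun γ α β => G γ β α) Q B A N M (fun α u => -S α u) where
  smooth_A := hL.smooth_B
  smooth_B := hL.smooth_A
  smooth_M := hL.smooth_N
  smooth_N := hL.smooth_M
  char_eq α u hu := by rw [hL.char_eq α u hu, neg_sub]
  curvature α β u hu := by
    simp only [smul_neg, Finset.sum_neg_distrib, ← hL.curvature β α u hu]
    rw [hbr.skew (B α u)]
    abel
  deriv_M := hL.deriv_N
  deriv_N := hL.deriv_M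
  bracket_MN u hu := by
    simp only [smul_neg, Finset.sum_neg_distrib, ← hL.bracket_MN u hu]
    exact hbr.skew _ _

/-- The curvature `∂_α B_β - ∂_β B_α - [B_α, B_β]` of the connection `d - B` commutes with the
covariantly constant section `M`. -/
theorem LaxCoefficients.bracket_curvature (hΩ : IsOpen Ω) (hbr : IsLieBracket br)
    (hL : LaxCoefficients Ω br G Q A B M N S) (α β : Fin n) {u : Fin n → ℝ} (hu : u ∈ Ω) :
    br (coordDeriv α (B β) u - coordDeriv β (B α) u - br (B α u) (B β u)) (M u) = 0 := by
  have hdB := fun γ => smooth_differentiableAt hΩ (hL.smooth_B γ) hu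
  have hdM := smooth_differentiableAt hΩ hL.smooth_M hu
  have key : ∀ γ δ, coordDeriv γ (coordDeriv δ M) u
      = br (coordDeriv γ (B δ) u) (M u) + br (B δ u) (br (B γ u) (M u)) := by
    intro γ δ
    rw [coordDeriv_congr hΩ (hL.deriv_M δ) γ hu, coordDeriv_bilinear br (hdB δ) hdM,
      hL.deriv_M γ u hu]
  have hc := coordDeriv_comm hΩ hL.smooth_M α β hu
  rw [key, key, hbr.leibniz (B α u) (B β u) (M u)] at hc
  simp only [map_sub, sub_apply]
  rw [← sub_eq_zero] at hc
  rw [← hc]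
  abel

variable {f : ContinuousMultilinearMap ℝ (fun _ : Fin (q + 1) => W) K}

/-- The two-form `f([B_α, B_β], M, …, M)` is closed. -/
theorem LaxCoefficients.closed (hΩ : IsOpen Ω) (hbr : IsLieBracket br) (hinv : IsInvariant br f)
    (hL : LaxCoefficients Ω br G Q A B M N S) (α β γ : Fin n) {u : Fin n → ℝ} (hu : u ∈ Ω) :
    coordDeriv α (fun v => formValue f (br (B β v) (B γ v)) (M v)) u
      + coordDeriv β (fun v => formValue f (br (B γ v) (B α v)) (M v)) u
      + coordDeriv γ (fun v => formValue f (br (B α v) (B β v)) (M v)) u = 0 := by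
  have hdB := fun δ => smooth_differentiableAt hΩ (hL.smooth_B δ) hu
  have hdM := smooth_differentiableAt hΩ hL.smooth_M hu
  have key : ∀ δ ε ζ, coordDeriv δ (fun v => formValue f (br (B ε v) (B ζ v)) (M v)) u
      = formValue f (br (coordDeriv δ (B ε) u) (B ζ u) + br (B ε u) (coordDeriv δ (B ζ) u)
        - br (B δ u) (br (B ε u) (B ζ u))) (M u) := by
    intro δ ε ζ
    have hd : DifferentiableAt ℝ (fun v => br (B ε v) (B ζ v)) u :=
      (br.hasFDerivAt_of_bilinear (hdB ε).hasFDerivAt (hdB ζ).hasFDerivAt).differentiableAt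
    rw [coordDeriv_formValue hinv hd hdM (hL.deriv_M δ u hu),
      coordDeriv_bilinear br (hdB ε) (hdB ζ)]
  have hF : ∀ δ ε ζ, formValue f (br (coordDeriv δ (B ε) u - coordDeriv ε (B δ) u
      - br (B δ u) (B ε u)) (B ζ u)) (M u) = 0 := fun δ ε ζ =>
    formValue_bracket_eq_zero_of_commute hinv (hL.bracket_curvature hΩ hbr δ ε hu)
  have h0 := congrArg₂ (· + ·) (congrArg₂ (· + ·) (hF α β γ) (hF β γ α)) (hF γ α β)
  simp only [add_zero, ← formValue_add] at h0
  rw [key, key, key, ← formValue_add, ← formValue_add, ← h0]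
  congr 1
  simp only [map_sub, sub_apply]
  rw [hbr.skew (B β u) (coordDeriv α (B γ) u), hbr.skew (B γ u) (coordDeriv β (B α) u),
    hbr.skew (B α u) (coordDeriv γ (B β) u), hbr.skew (br (B α u) (B β u)),
    hbr.skew (br (B β u) (B γ u)), hbr.skew (br (B γ u) (B α u))]
  have hj := hbr.leibniz (B α u) (B β u) (B γ u)
  rw [hbr.skew (br (B α u) (B β u)), hbr.skew (B α u) (B γ u), map_neg] at hj
  have hj' : br (B α u) (br (B β u) (B γ u)) + br (B β u) (br (B γ u) (B α u))
      + br (B γ u) (br (B α u) (B β u)) = 0 := by rw [hj]; abel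
  rw [← sub_eq_zero]
  -- the difference of the two sides is twice the Jacobi sum, up to sign
  have : ∀ J : W, J = 0 → -(2 : ℤ) • J = 0 := fun J hJ => by rw [hJ, smul_zero]
  rw [← this _ hj']
  abel

/-- The coefficients of `U_x U_y` in `R_γ Δ^γ`, where `R_γ = f(S_γ, M, …, M)`. -/
theorem LaxCoefficients.sum_smul_formValue (hΩ : IsOpen Ω) (hbr : IsLieBracket br)
    (hinv : IsInvariant br f) (hL : LaxCoefficients Ω br G Q A B M N S) (α β : Fin n)
    {u : Fin n → ℝ} (hu : u ∈ Ω) :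
    ∑ γ, G γ α β u • formValue f (S γ u) (M u)
      = coordDeriv β (fun v => formValue f (A α v) (M v)) u
        - coordDeriv α (fun v => formValue f (B β v) (M v)) u
        - formValue f (br (B α u) (B β u)) (M u) := by
  have hdM := smooth_differentiableAt hΩ hL.smooth_M hu
  rw [coordDeriv_formValue hinv (smooth_differentiableAt hΩ (hL.smooth_A α) hu) hdM
      (hL.deriv_M β u hu),
    coordDeriv_formValue hinv (smooth_differentiableAt hΩ (hL.smooth_B β) hu) hdM
      (hL.deriv_M α u hu), ← formValue_sum_smul, ← hL.curvature α β u hu, ← formValue_sub,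
    ← formValue_sub, hbr.skew (A α u)]
  congr 1
  abel

end LaxCoefficients

/-! ### Conserved quasilinear functions -/

section Conserved

variable {n q : ℕ} {W K : Type*} [NormedAddCommGroup W] [NormedSpace ℝ W]
  [NormedAddCommGroup K] [NormedSpace ℝ K] {Ω : Set (Fin n → ℝ)}
  {G : Fin n → Fin n → Fin n → (Fin n → ℝ) → ℝ} {Q : Fin n → (Fin n → ℝ) → ℝ}

/-- The functions `r_α` of the dependent variables satisfy `r_γ Q^γ = 0` and are of the form
`r = a - b` with `r_γ G^γ_{αβ} = ∂_β a_α - ∂_α b_β - η_{αβ}` for one-forms `a`, `b` and a closed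
two-form `η`. -/
structure IsConserved (Ω : Set (Fin n → ℝ)) (G : Fin n → Fin n → Fin n → (Fin n → ℝ) → ℝ)
    (Q : Fin n → (Fin n → ℝ) → ℝ) (r a b : Fin n → (Fin n → ℝ) → K)
    (η : Fin n → Fin n → (Fin n → ℝ) → K) : Prop where
  smooth_a : ∀ α, ContDiffOn ℝ ∞ (a α) Ω
  smooth_b : ∀ α, ContDiffOn ℝ ∞ (b α) Ω
  smooth_η : ∀ α β, ContDiffOn ℝ ∞ (η α β) Ω
  char_eq : ∀ α, ∀ u ∈ Ω, r α u = a α u - b α u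
  sum_G : ∀ α β, ∀ u ∈ Ω,
    ∑ γ, G γ α β u • r γ u = coordDeriv β (a α) u - coordDeriv α (b β) u - η α β u
  sum_Q : ∀ u ∈ Ω, ∑ γ, Q γ u • r γ u = 0
  skew : ∀ α β, ∀ u ∈ Ω, η α β u = -η β α u
  closed : ∀ α β γ, ∀ u ∈ Ω,
    coordDeriv α (η β γ) u + coordDeriv β (η γ α) u + coordDeriv γ (η α β) u = 0

/-- The characteristic `f(S_α, M, …, M)` is conserved, with `a_α = f(A_α, M, …, M)`,
`b_α = f(B_α, M, …, M)` and `η_{αβ} = f([B_α, B_β], M, …, M)`. -/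
theorem LaxCoefficients.isConserved {br : W →L[ℝ] W →L[ℝ] W}
    {f : ContinuousMultilinearMap ℝ (fun _ : Fin (q + 1) => W) K}
    {A B S : Fin n → (Fin n → ℝ) → W} {M N : (Fin n → ℝ) → W}
    (hΩ : IsOpen Ω) (hbr : IsLieBracket br) (hinv : IsInvariant br f)
    (hsymm : ∀ (σ : Equiv.Perm (Fin (q + 1))) (x : Fin (q + 1) → W), f (fun i => x (σ i)) = f x)
    (hL : LaxCoefficients Ω br G Q A B M N S) :
    IsConserved Ω G Q (fun α u => formValue f (S α u) (M u))
      (fun α u => formValue f (A α u) (M u)) (fun α u => formValue f (B α u) (M u))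
      (fun α β u => formValue f (br (B α u) (B β u)) (M u)) where
  smooth_a α := smooth_formValue (hL.smooth_A α) hL.smooth_M
  smooth_b α := smooth_formValue (hL.smooth_B α) hL.smooth_M
  smooth_η α β := smooth_formValue
    ((br.contDiff.comp_contDiffOn (hL.smooth_B α)).clm_apply (hL.smooth_B β)) hL.smooth_M
  char_eq α u hu := by rw [hL.char_eq α u hu, formValue_sub]
  sum_G α β u hu := hL.sum_smul_formValue hΩ hbr hinv α β hu
  sum_Q u hu := by
    rw [← formValue_sum_smul, ← hL.bracket_MN u hu, hbr.skew, formValue_neg,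
      formValue_bracket_self hinv hsymm, neg_zero]
  skew α β u hu := by rw [hbr.skew, formValue_neg]
  closed α β γ u hu := hL.closed hΩ hbr hinv α β γ hu

variable {r a b : Fin n → (Fin n → ℝ) → K} {η : Fin n → Fin n → (Fin n → ℝ) → K}

/-- Undoing the interchange of `x` and `y`. -/
theorem IsConserved.swap
    (h : IsConserved Ω (fun γ α β => G γ β α) Q (fun α u => -r α u) a b η) :
    IsConserved Ω G Q r b a η where
  smooth_a := h.smooth_b
  smooth_b := h.smooth_a
  smooth_η := h.smooth_η
  char_eq α u hu := by rw [← neg_sub, ← h.char_eq α u hu, neg_neg]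
  sum_G α β u hu := by
    have := h.sum_G β α u hu
    simp only [smul_neg, Finset.sum_neg_distrib] at this
    rw [← neg_neg (∑ γ, _), this, h.skew β α u hu]
    abel
  sum_Q u hu := by
    have := h.sum_Q u hu
    simpa only [smul_neg, Finset.sum_neg_distrib, neg_eq_zero] using this
  skew := h.skew
  closed := h.closed

theorem IsConserved.mono {V : Set (Fin n → ℝ)} (h : IsConserved Ω G Q r a b η) (hV : V ⊆ Ω) :
    IsConserved V G Q r a b η where
  smooth_a α := (h.smooth_a α).mono hV
  smooth_b α := (h.smooth_b α).mono hV
  smooth_η α β := (h.smooth_η α β).mono hV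
  char_eq α u hu := h.char_eq α u (hV hu)
  sum_G α β u hu := h.sum_G α β u (hV hu)
  sum_Q u hu := h.sum_Q u (hV hu)
  skew α β u hu := h.skew α β u (hV hu)
  closed α β γ u hu := h.closed α β γ u (hV hu)

/-- The term `r_γ Q^γ` vanishes, so that `r_γ Δ^γ` is quasilinear without zeroth-order part. -/
theorem IsConserved.sum_smul (h : IsConserved Ω G Q r a b η) {z : JetSpace n}
    (hz : fieldValue z ∈ Ω) :
    ∑ γ, chiralLHS G Q γ z • r γ (fieldValue z)
      = quasilinear (fun γ u => a γ u - b γ u)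
        (fun α β u => coordDeriv β (a α) u - coordDeriv α (b β) u - η α β u) z := by
  simp only [quasilinear, chiralLHS, add_smul, Finset.sum_add_distrib, h.sum_Q _ hz, add_zero,
    ← h.char_eq _ _ hz, ← h.sum_G _ _ _ hz, Finset.smul_sum, Finset.sum_smul, smul_smul]
  congr 1
  rw [Finset.sum_comm]
  refine Finset.sum_congr rfl fun β _ => ?_
  rw [Finset.sum_comm]
  refine Finset.sum_congr rfl fun γ _ => Finset.sum_congr rfl fun α _ => ?_
  congr 1; ring

/-- The contributions of `a` and `b` cancel by symmetry of second derivatives, and those of `η`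
add up to `dη = 0`. -/
theorem IsConserved.euler_eq_zero (hΩ : IsOpen Ω) (h : IsConserved Ω G Q r a b η) (α : Fin n)
    {z : JetSpace n} (hz : fieldValue z ∈ Ω) :
    euler α (fun w => ∑ γ, chiralLHS G Q γ w • r γ (fieldValue w)) z = 0 := by
  have ha := fun α β => smooth_coordDeriv hΩ (h.smooth_a α) β
  have hb := fun α β => smooth_coordDeriv hΩ (h.smooth_b α) β
  rw [euler_congr hΩ (fun _ hw => h.sum_smul hw) α hz]
  refine euler_quasilinear_eq_zero hΩ (fun γ => (h.smooth_a γ).sub (h.smooth_b γ))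
    (fun β γ => ((ha β γ).sub (hb γ β)).sub (h.smooth_η β γ)) ?_ ?_ α hz
  · intro α γ u hu
    rw [coordDeriv_sub (smooth_differentiableAt hΩ (h.smooth_a γ) hu)
        (smooth_differentiableAt hΩ (h.smooth_b γ) hu),
      coordDeriv_sub (smooth_differentiableAt hΩ (h.smooth_a α) hu)
        (smooth_differentiableAt hΩ (h.smooth_b α) hu), h.skew γ α u hu]
    abel
  · intro α β γ u hu
    have hda := fun β γ => smooth_differentiableAt hΩ (ha β γ) hu
    have hdb := fun β γ => smooth_differentiableAt hΩ (hb β γ) hu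
    have hdη := fun β γ => smooth_differentiableAt hΩ (h.smooth_η β γ) hu
    have e1 : ∀ δ ε ζ, coordDeriv δ
        (fun u => coordDeriv ζ (a ε) u - coordDeriv ε (b ζ) u - η ε ζ u) u
        = coordDeriv δ (coordDeriv ζ (a ε)) u - coordDeriv δ (coordDeriv ε (b ζ)) u
          - coordDeriv δ (η ε ζ) u := by
      intro δ ε ζ
      rw [coordDeriv_sub ((hda ε ζ).fun_sub (hdb ζ ε)) (hdη ε ζ),
        coordDeriv_sub (hda ε ζ) (hdb ζ ε)]
    have e2 : coordDeriv β (coordDeriv γ fun u => a α u - b α u) u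
        = coordDeriv β (coordDeriv γ (a α)) u - coordDeriv β (coordDeriv γ (b α)) u := by
      rw [coordDeriv_congr hΩ (fun v hv => coordDeriv_sub
        (smooth_differentiableAt hΩ (h.smooth_a α) hv)
        (smooth_differentiableAt hΩ (h.smooth_b α) hv) γ) β hu, coordDeriv_sub (hda α γ) (hdb α γ)]
    have e3 : coordDeriv β (η γ α) u = -coordDeriv β (η α γ) u := by
      rw [coordDeriv_congr hΩ (h.skew γ α) β hu, coordDeriv_neg]
    have e4 : coordDeriv γ (η α β) u = -coordDeriv γ (η β α) u := by
      rw [coordDeriv_congr hΩ (h.skew α β) γ hu, coordDeriv_neg]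
    have hcl := h.closed α β γ u hu
    rw [e3, e4] at hcl
    rw [e1, e1, e1, e2, coordDeriv_comm hΩ (h.smooth_a β) α γ hu,
      coordDeriv_comm hΩ (h.smooth_b γ) α β hu, coordDeriv_comm hΩ (h.smooth_b α) γ β hu,
      ← neg_eq_zero, ← hcl]
    abel

/-- A function of first derivatives that is linear in them is a differential function. -/
theorem isDifferentialFunction_sum_jet_smul {i j : ℕ} {V : Set (Fin n → ℝ)}
    {X : Fin n → (Fin n → ℝ) → K} (hX : ∀ α, ContDiffOn ℝ ∞ (X α) V) :
    IsDifferentialFunction V (fun z => ∑ α, jet z i j α • X α (fieldValue z)) := by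
  refine ⟨i + j, fun w => ∑ α, w.2.2 (Fin.ofNat _ i) (Fin.ofNat _ j) α • X α (w.2.2 0 0), ?_, ?_⟩
  · refine ContDiffOn.sum fun α _ => ContDiffOn.smul (ContDiff.contDiffOn (by fun_prop))
      ((hX α).comp (ContDiff.contDiffOn (by fun_prop)) fun w hw => hw)
  · intro z _
    have hi : i % (i + j + 1) = i := Nat.mod_eq_of_lt (by omega)
    have hj : j % (i + j + 1) = j := Nat.mod_eq_of_lt (by omega)
    simp [truncate, jet, fieldValue, hi, hj]

theorem isDifferentialFunction_fieldValue {V : Set (Fin n → ℝ)}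
    {X : (Fin n → ℝ) → K} (hX : ContDiffOn ℝ ∞ X V) :
    IsDifferentialFunction V (fun z => X (fieldValue z)) :=
  ⟨0, fun w => X (w.2.2 0 0), hX.comp (ContDiff.contDiffOn (by fun_prop)) fun _ hw => hw,
    fun _ _ => rfl⟩

/-- On a star-shaped domain a primitive `θ` of the closed two-form `η` yields the conserved
current `L₁ = (-b_β - θ_β) U^β_y`, `L₂ = (a_α + θ_α) U^α_x`. -/
theorem IsConserved.isCharacteristic [CompleteSpace K] {V : Set (Fin n → ℝ)} {c : Fin n → ℝ}
    (hV : IsOpen V) (hc : StarConvex ℝ c V) (h : IsConserved V G Q r a b η) :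
    IsCharacteristic V (chiralLHS G Q) (fun α z => r α (fieldValue z)) := by
  obtain ⟨θ, hθ, hdθ⟩ := exists_primitive_of_closed_twoForm hV hc h.smooth_η h.skew h.closed
  have h1 : ∀ α, ContDiffOn ℝ ∞ (fun u => -b α u - θ α u) V := fun α =>
    (h.smooth_b α).neg.sub (hθ α)
  have h2 : ∀ α, ContDiffOn ℝ ∞ (fun u => a α u + θ α u) V := fun α => (h.smooth_a α).add (hθ α)
  refine ⟨fun α => isDifferentialFunction_fieldValue
      (((h.smooth_a α).sub (h.smooth_b α)).congr (h.char_eq α)),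
    fun z => ∑ α, jet z 0 1 α • (-b α (fieldValue z) - θ α (fieldValue z)),
    fun z => ∑ α, jet z 1 0 α • (a α (fieldValue z) + θ α (fieldValue z)),
    isDifferentialFunction_sum_jet_smul h1, isDifferentialFunction_sum_jet_smul h2, ?_⟩
  intro z hz
  rw [Dx_sum_Uy hV h1 hz, Dy_sum_Ux hV h2 hz, h.sum_smul hz, quasilinear, add_add_add_comm]
  simp only [← Finset.sum_add_distrib, ← smul_add]
  refine Finset.sum_congr rfl fun α _ => ?_
  congr 1
  · congr 1; abel
  · refine Finset.sum_congr rfl fun β _ => ?_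
    have hd := fun γ => smooth_differentiableAt hV (hθ γ) hz
    have hdb := smooth_differentiableAt hV (h.smooth_b β) hz
    rw [coordDeriv_sub hdb.fun_neg (hd β), coordDeriv_neg,
      coordDeriv_add (smooth_differentiableAt hV (h.smooth_a α) hz) (hd α), ← hdθ α β _ hz]
    congr 1; abel

end Conserved

/-! ### Extracting the coefficients from the Lax identity -/

section Extraction

variable {n : ℕ} {W : Type*} [NormedAddCommGroup W] [NormedSpace ℝ W] {Ω : Set (Fin n → ℝ)}
  {br : W →L[ℝ] W →L[ℝ] W}
  {G : Fin n → Fin n → Fin n → (Fin n → ℝ) → ℝ} {Q : Fin n → (Fin n → ℝ) → ℝ}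
  {A B S : Fin n → (Fin n → ℝ) → W} {M N : (Fin n → ℝ) → W}

/-- The point of the jet space with `U = u`, `U_x = p`, `U_y = q`, `U_{xy} = s` and all other
coordinates zero. -/
def jetPoint (u p q s : Fin n → ℝ) : JetSpace n :=
  (0, 0, fun i j => match i, j with
    | 0, 0 => u
    | 1, 0 => p
    | 0, 1 => q
    | 1, 1 => s
    | _, _ => 0)

/-- The Lax identity holds for arbitrary values of the jet coordinates; it is evaluated at
coordinate vectors for `U_x`, `U_y`, `U_{xy}`, starting from the zeroth-order term. -/
theorem LaxCoefficients.of_identity (hbr : IsLieBracket br)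
    (smooth_A : ∀ α, ContDiffOn ℝ ∞ (A α) Ω) (smooth_B : ∀ α, ContDiffOn ℝ ∞ (B α) Ω)
    (smooth_M : ContDiffOn ℝ ∞ M Ω) (smooth_N : ContDiffOn ℝ ∞ N Ω)
    (hId : ∀ z : JetSpace n, fieldValue z ∈ Ω →
      (∑ β, jet z 1 1 β • A β (fieldValue z)
        + ∑ β, ∑ γ, (jet z 1 0 β * jet z 0 1 γ) • coordDeriv γ (A β) (fieldValue z)
        + ∑ β, jet z 0 1 β • coordDeriv β M (fieldValue z))
      - (∑ β, jet z 1 1 β • B β (fieldValue z)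
        + ∑ β, ∑ γ, (jet z 1 0 β * jet z 0 1 γ) • coordDeriv β (B γ) (fieldValue z)
        + ∑ β, jet z 1 0 β • coordDeriv β N (fieldValue z))
      + br (∑ β, jet z 1 0 β • A β (fieldValue z) + M (fieldValue z))
        (∑ β, jet z 0 1 β • B β (fieldValue z) + N (fieldValue z))
      = ∑ γ, chiralLHS G Q γ z • S γ (fieldValue z)) :
    LaxCoefficients Ω br G Q A B M N S := by
  have hId' : ∀ u ∈ Ω, ∀ p q s : Fin n → ℝ,
      (∑ β, s β • A β u + ∑ β, ∑ γ, (p β * q γ) • coordDeriv γ (A β) u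
        + ∑ β, q β • coordDeriv β M u)
      - (∑ β, s β • B β u + ∑ β, ∑ γ, (p β * q γ) • coordDeriv β (B γ) u
        + ∑ β, p β • coordDeriv β N u)
      + br (∑ β, p β • A β u + M u) (∑ β, q β • B β u + N u)
      = ∑ γ, (s γ + ∑ α, ∑ β, G γ α β u * p α * q β + Q γ u) • S γ u :=
    fun u hu p q s => hId (jetPoint u p q s) hu
  have hMN : ∀ u ∈ Ω, br (M u) (N u) = ∑ α, Q α u • S α u := by
    intro u hu
    simpa using hId' u hu 0 0 0
  have hN : ∀ α, ∀ u ∈ Ω, coordDeriv α N u = br (A α u) (N u) := by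
    intro α u hu
    have h := hId' u hu (Pi.single α 1) 0 0
    simp [Pi.single_apply, ← hMN u hu] at h
    rw [← sub_eq_zero, ← neg_eq_zero, ← sub_eq_zero.2 h]
    abel
  have hM : ∀ β, ∀ u ∈ Ω, coordDeriv β M u = br (B β u) (M u) := by
    intro β u hu
    have h := hId' u hu 0 (Pi.single β 1) 0
    simp [Pi.single_apply, ← hMN u hu] at h
    rw [hbr.skew, eq_neg_iff_add_eq_zero, ← sub_eq_zero.2 h]
    abel
  refine ⟨smooth_A, smooth_B, smooth_M, smooth_N, ?_, ?_, hM, hN, hMN⟩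
  · intro α u hu
    have h := hId' u hu 0 0 (Pi.single α 1)
    simp [Pi.single_apply, add_smul, Finset.sum_add_distrib, ← hMN u hu] at h
    exact h.symm
  · intro α β u hu
    have h := hId' u hu (Pi.single α 1) (Pi.single β 1) 0
    simp [Pi.single_apply, add_smul, Finset.sum_add_distrib, ← hMN u hu, hM β u hu,
      hN α u hu, hbr.skew (M u) (B β u)] at h
    rw [← sub_eq_zero, ← sub_eq_zero.2 h]
    abel

end Extraction

/-! ### Coordinates on a matrix Lie algebra -/

section MatrixLie

variable {n m q : ℕ} {𝕂 : Type*} [RCLike 𝕂] (𝔤 : LieSubalgebra ℝ (Matrix (Fin m) (Fin m) 𝕂))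

instance finite_lieSubalgebra : Module.Finite ℝ 𝔤 :=
  inferInstanceAs (Module.Finite ℝ 𝔤.toSubmodule)

/-- The space of coordinate vectors of elements of `𝔤`. -/
abbrev Coords : Type := Fin (Module.finrank ℝ 𝔤) → ℝ

/-- Linear coordinates on the matrix Lie algebra `𝔤`. -/
def coords : 𝔤 ≃ₗ[ℝ] Coords 𝔤 := (Module.finBasis ℝ 𝔤).equivFun

/-- The Lie bracket in coordinates. -/
def coordsBracket : Coords 𝔤 →L[ℝ] Coords 𝔤 →L[ℝ] Coords 𝔤 :=
  LinearMap.toContinuousLinearMap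
    ((LinearMap.toContinuousLinearMap (𝕜 := ℝ) (E := Coords 𝔤) (F' := Coords 𝔤)).toLinearMap ∘ₗ
      LinearMap.mk₂ ℝ (fun x y => coords 𝔤 ⁅(coords 𝔤).symm x, (coords 𝔤).symm y⁆)
        (by simp) (by simp) (by simp) (by simp))

theorem coordsBracket_apply (x y : Coords 𝔤) :
    coordsBracket 𝔤 x y = coords 𝔤 ⁅(coords 𝔤).symm x, (coords 𝔤).symm y⁆ := rfl

theorem isLieBracket_coordsBracket : IsLieBracket (coordsBracket 𝔤) where
  skew x y := by
    rw [coordsBracket_apply, coordsBracket_apply, ← map_neg, lie_skew]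
  leibniz x y z := by
    simp only [coordsBracket_apply, LinearEquiv.symm_apply_apply, ← map_add]
    rw [leibniz_lie]

/-- The entry functional `X ↦ X i j` in coordinates. -/
def coordsEntry (i j : Fin m) : Coords 𝔤 →L[ℝ] 𝕂 :=
  LinearMap.toContinuousLinearMap
    { toFun := fun x => ((coords 𝔤).symm x : Matrix (Fin m) (Fin m) 𝕂) i j
      map_add' := by simp
      map_smul' := by simp }

theorem coordsEntry_apply (i j : Fin m) (x : Coords 𝔤) :
    coordsEntry 𝔤 i j x = ((coords 𝔤).symm x : Matrix (Fin m) (Fin m) 𝕂) i j := rfl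

theorem coordsEntry_coords (i j : Fin m) (X : 𝔤) :
    coordsEntry 𝔤 i j (coords 𝔤 X) = (X : Matrix (Fin m) (Fin m) 𝕂) i j := by
  rw [coordsEntry_apply, LinearEquiv.symm_apply_apply]

theorem eq_of_coordsEntry_eq {x y : Coords 𝔤}
    (h : ∀ i j, coordsEntry 𝔤 i j x = coordsEntry 𝔤 i j y) : x = y := by
  refine (coords 𝔤).symm.injective (Subtype.ext ?_)
  ext i j
  exact h i j

variable {𝔤}

/-- The coordinates are smooth functions of the matrix entries, since the coordinate map extends to
a linear map on all matrices. -/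
theorem smooth_coords {Ω : Set (Fin n → ℝ)} {X : (Fin n → ℝ) → 𝔤} (hX : SmoothMatrixOn Ω X) :
    ContDiffOn ℝ ∞ (fun u => coords 𝔤 (X u)) Ω := by
  obtain ⟨g, hg⟩ := LinearMap.exists_extend (p := 𝔤.toSubmodule) (coords 𝔤).toLinearMap
  have hg' : ∀ u, coords 𝔤 (X u) = LinearMap.toContinuousLinearMap
      (g ∘ₗ (Matrix.ofLinearEquiv ℝ (m := Fin m) (n := Fin m) (α := 𝕂)).toLinearMap)
      (fun i j => (X u : Matrix (Fin m) (Fin m) 𝕂) i j) := fun u =>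
    (LinearMap.congr_fun hg (X u)).symm
  simp only [hg']
  exact (ContinuousLinearMap.contDiff _).comp_contDiffOn
    (contDiffOn_pi.2 fun i => contDiffOn_pi.2 fun j => hX i j)

/-- A multilinear form on `𝔤` in coordinates; it is continuous, being a polynomial. -/
def coordsForm {K : Type*} [NormedAddCommGroup K] [NormedSpace ℝ K]
    (f : MultilinearMap ℝ (fun _ : Fin (q + 1) => 𝔤) K) :
    ContinuousMultilinearMap ℝ (fun _ : Fin (q + 1) => Coords 𝔤) K where
  toMultilinearMap := f.compLinearMap fun _ => (coords 𝔤).symm.toLinearMap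
  cont := by
    set g := f.compLinearMap fun _ => (coords 𝔤).symm.toLinearMap with hg
    have h : ∀ x : Fin (q + 1) → Coords 𝔤, g x
        = ∑ r : Fin (q + 1) → Fin (Module.finrank ℝ 𝔤),
          (∏ i, x i (r i)) • g fun i => Pi.single (r i) 1 := by
      intro x
      conv_lhs => rw [show x = fun i => ∑ j, x i j • (Pi.single j 1 : Coords 𝔤) from
        funext fun i => pi_eq_sum_univ' (x i)]
      rw [g.map_sum]
      exact Finset.sum_congr rfl fun r _ => g.map_smul_univ _ _
    change Continuous fun x => g x
    rw [funext h]
    fun_prop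

section Form

variable {K : Type*} [NormedAddCommGroup K] [NormedSpace ℝ K]
  {f : MultilinearMap ℝ (fun _ : Fin (q + 1) => 𝔤) K}

theorem coordsForm_apply (x : Fin (q + 1) → Coords 𝔤) :
    coordsForm f x = f fun i => (coords 𝔤).symm (x i) := rfl

theorem isInvariant_coordsForm (hinv : IsAdInvariant f) :
    IsInvariant (coordsBracket 𝔤) (coordsForm f) := by
  intro y x
  rw [← hinv ((coords 𝔤).symm y) fun i => (coords 𝔤).symm (x i)]
  refine Finset.sum_congr rfl fun i _ => ?_
  rw [coordsForm_apply]
  congr 1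
  funext j
  by_cases hj : j = i
  · subst hj
    simp [coordsBracket_apply]
  · simp [hj]

theorem coordsForm_perm (hsymm : IsSymmetricForm f) (σ : Equiv.Perm (Fin (q + 1)))
    (x : Fin (q + 1) → Coords 𝔤) : coordsForm f (fun i => x (σ i)) = coordsForm f x :=
  hsymm σ fun i => (coords 𝔤).symm (x i)

theorem formCharacteristic_eq (S : Fin n → (Fin n → ℝ) → 𝔤) (X : (Fin n → ℝ) → 𝔤) (α : Fin n)
    (z : JetSpace n) : formCharacteristic f S X α z
      = formValue (coordsForm f) (coords 𝔤 (S α (fieldValue z))) (coords 𝔤 (X (fieldValue z))) := by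
  rw [formCharacteristic, formValue, coordsForm_apply]
  congr 1
  funext i
  refine Fin.cases ?_ (fun j => ?_) i <;> simp

end Form

/-- A Lax representation in `𝔤` satisfies the coefficient identities in coordinates. -/
theorem IsLaxRepresentation.laxCoefficients {Ω : Set (Fin n → ℝ)} (hΩ : IsOpen Ω)
    {G : Fin n → Fin n → Fin n → (Fin n → ℝ) → ℝ} {Q : Fin n → (Fin n → ℝ) → ℝ}
    {A B : Fin n → (Fin n → ℝ) → 𝔤} {M N : (Fin n → ℝ) → 𝔤} {S : Fin n → (Fin n → ℝ) → 𝔤}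
    (hLax : IsLaxRepresentation Ω (chiralLHS G Q) A B M N S) :
    LaxCoefficients Ω (coordsBracket 𝔤) G Q (fun α u => coords 𝔤 (A α u))
      (fun α u => coords 𝔤 (B α u)) (fun u => coords 𝔤 (M u)) (fun u => coords 𝔤 (N u))
      (fun α u => coords 𝔤 (S α u)) := by
  have sA := fun α => smooth_coords (hLax.smooth_A α)
  have sB := fun α => smooth_coords (hLax.smooth_B α)
  have sM := smooth_coords hLax.smooth_M
  have sN := smooth_coords hLax.smooth_N
  refine LaxCoefficients.of_identity (isLieBracket_coordsBracket 𝔤) sA sB sM sN ?_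
  intro z hz
  refine eq_of_coordsEntry_eq 𝔤 fun i j => ?_
  have hLs : ∀ {X : (Fin n → ℝ) → Coords 𝔤}, ContDiffOn ℝ ∞ X Ω →
      ContDiffOn ℝ ∞ (fun u => coordsEntry 𝔤 i j (X u)) Ω := fun hX =>
    (coordsEntry 𝔤 i j).contDiff.comp_contDiffOn hX
  have hLd : ∀ {X : (Fin n → ℝ) → Coords 𝔤}, ContDiffOn ℝ ∞ X Ω → ∀ α,
      coordDeriv α (fun u => coordsEntry 𝔤 i j (X u)) (fieldValue z)
        = coordsEntry 𝔤 i j (coordDeriv α X (fieldValue z)) := fun hX α =>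
    coordDeriv_clm _ (smooth_differentiableAt hΩ hX hz) α
  have eA : (fun w => laxA A M w i j) = fun w =>
      ∑ α, jet w 1 0 α • coordsEntry 𝔤 i j (coords 𝔤 (A α (fieldValue w)))
        + coordsEntry 𝔤 i j (coords 𝔤 (M (fieldValue w))) := by
    funext w
    simp [laxA, coordsEntry_coords, Matrix.sum_apply]
  have eB : (fun w => laxB B N w i j) = fun w =>
      ∑ α, jet w 0 1 α • coordsEntry 𝔤 i j (coords 𝔤 (B α (fieldValue w)))
        + coordsEntry 𝔤 i j (coords 𝔤 (N (fieldValue w))) := by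
    funext w
    simp [laxB, coordsEntry_coords, Matrix.sum_apply]
  have hDy : Dy (fun w => laxA A M w i j) z = _ := (congrArg (fun P => Dy P z) eA).trans
    (Dy_sum_Ux_add hΩ (fun α => hLs (sA α)) (hLs sM) hz)
  have hDx : Dx (fun w => laxB B N w i j) z = _ := (congrArg (fun P => Dx P z) eB).trans
    (Dx_sum_Uy_add hΩ (fun α => hLs (sB α)) (hLs sN) hz)
  have hbrk : (⁅laxA A M z, laxB B N z⁆ : Matrix (Fin m) (Fin m) 𝕂) i j
      = coordsEntry 𝔤 i j (coordsBracket 𝔤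
        (∑ α, jet z 1 0 α • coords 𝔤 (A α (fieldValue z)) + coords 𝔤 (M (fieldValue z)))
        (∑ α, jet z 0 1 α • coords 𝔤 (B α (fieldValue z)) + coords 𝔤 (N (fieldValue z)))) := by
    simp only [← map_smul, ← map_sum, ← map_add]
    rw [coordsBracket_apply, coordsEntry_coords, LinearEquiv.symm_apply_apply,
      LinearEquiv.symm_apply_apply, LieSubalgebra.coe_bracket]
    simp [laxA, laxB]
  have h := congrFun (congrFun (hLax.identity z hz) i) j
  rw [Matrix.add_apply, Matrix.sub_apply, matrixDy, matrixDx, Matrix.of_apply, Matrix.of_apply,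
    hDy, hDx, hbrk, Matrix.sum_apply] at h
  simp only [hLd (sA _), hLd (sB _), hLd sM, hLd sN] at h
  simp only [map_add, map_sub, map_sum, map_smul, coordsEntry_coords 𝔤 i j (S _ _),
    Matrix.smul_apply] at h ⊢
  exact h

end MatrixLie

end ChiralType

end

open ChiralType in
theorem theorem1 {n m q : ℕ} {𝕂 𝕜 : Type*} [RCLike 𝕂] [RCLike 𝕜]
    (Ω : Set (Fin n → ℝ)) (hΩ : IsOpen Ω)
    (G : Fin n → Fin n → Fin n → (Fin n → ℝ) → ℝ) (Q : Fin n → (Fin n → ℝ) → ℝ)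
    (hG : ∀ α β γ, ContDiffOn ℝ ∞ (G α β γ) Ω) (hQ : ∀ α, ContDiffOn ℝ ∞ (Q α) Ω)
    (𝔤 : LieSubalgebra ℝ (Matrix (Fin m) (Fin m) 𝕂))
    (A B : Fin n → (Fin n → ℝ) → 𝔤) (M N : (Fin n → ℝ) → 𝔤) (S : Fin n → (Fin n → ℝ) → 𝔤)
    (hLax : IsLaxRepresentation Ω (chiralLHS G Q) A B M N S)
    (f : MultilinearMap ℝ (fun _ : Fin (q + 1) => 𝔤) 𝕜)
    (hsymm : IsSymmetricForm f) (hinv : IsAdInvariant f) :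
    -- the characteristic element
    (∀ α, ∀ u ∈ Ω, S α u = A α u - B α u) ∧
    -- both sets of functions are characteristics of conservation laws
    (∀ (V : Set (Fin n → ℝ)) (c : Fin n → ℝ), IsOpen V → V ⊆ Ω → StarConvex ℝ c V →
      IsCharacteristic V (chiralLHS G Q) (formCharacteristic f S M) ∧
      IsCharacteristic V (chiralLHS G Q) (formCharacteristic f S N)) ∧
    -- the Euler operators annihilate `R_β Δ^β` over the whole domain
    (∀ (α : Fin n) (z : JetSpace n), fieldValue z ∈ Ω →
      euler α (fun w => ∑ β, chiralLHS G Q β w • formCharacteristic f S M β w) z = 0 ∧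
      euler α (fun w => ∑ β, chiralLHS G Q β w • formCharacteristic f S N β w) z = 0) := by
  have hbr := isLieBracket_coordsBracket 𝔤
  have hL := hLax.laxCoefficients hΩ
  have hinv' := isInvariant_coordsForm hinv
  have hM := hL.isConserved hΩ hbr hinv' (coordsForm_perm hsymm)
  have hN' := (hL.swap hbr).isConserved hΩ hbr hinv' (coordsForm_perm hsymm)
  simp only [formValue_neg] at hN'
  have hN := hN'.swap
  have eM : formCharacteristic f S M = _ := funext₂ (formCharacteristic_eq S M)
  have eN : formCharacteristic f S N = _ := funext₂ (formCharacteristic_eq S N)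
  refine ⟨fun α u hu => (coords 𝔤).injective ?_, fun V c hV hVΩ hc => ?_, fun α z hz => ?_⟩
  · rw [map_sub]
    exact hL.char_eq α u hu
  · rw [eM, eN]
    exact ⟨(hM.mono hVΩ).isCharacteristic hV hc, (hN.mono hVΩ).isCharacteristic hV hc⟩
  · rw [eM, eN]
    exact ⟨hM.euler_eq_zero hΩ α hz, hN.euler_eq_zero hΩ α hz⟩
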